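/- **Setting.** Let $\Omega\subseteq\mathbb R^{d}$ be open and bounded and let $E(\mu)=\sum_i f_i(\mu)E_i$, $A(\mu)=\sum_i g_i(\mu)A_i$, $B(\mu)=\sum_i h_i(\mu)B_i$, $C(\mu)=\sum_i k_i(\mu)C_i$ be finite sums with real matrices $E_i,A_i\in\mathbb R^{n\times n}$, $B_i\in\mathbb R^{n\times m}$, $C_i\in\mathbb R^{p\times n}$ and real-analytic $f_i,g_i,h_i,k_i:\Omega\to\mathbb R$. Put $D(\mu,s)=sE(\mu)-A(\mu)$ and let $H[\mu](s)=C(\mu)D(\mu,s)^{-1}B(\mu)$, a matrix of rational functions of $s$, defined if the pencil $D(\mu,\cdot)$ is regular. For a matrix let $\sigma_{\min}$ be its smallest singular value, and let $\sigma(\mu,\omega)$ and $\sigma_2(\mu,\omega)$ be the largest and second largest singular values of $H[\mu](\mathrm i\omega)$, $\omega\in\mathbb R$ (with $\sigma_2=0$ if there is only one). Let $\|H[\mu]\|_{\mathcal H_\infty}=\sup_{\operatorname{Re}s>0}\|H[\mu](s)\|_2$; we write $H[\mu]\in\mathcal H_\infty$ if $D(\mu,\cdot)$ is regular and this supremum is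 finite. Subscripts $\omega$ denote partial derivatives. For $V,W\in\mathbb C^{n\times r}$ with orthonormal columns, spanning $\mathcal V,\mathcal W$, let $D^{V,W}(\mu,s)=W^*D(\mu,s)V$, $H^{\mathcal V,\mathcal W}[\mu](s)=C(\mu)V\,D^{V,W}(\mu,s)^{-1}\,W^*B(\mu)$, and let $\sigma^{\mathcal V,\mathcal W},\sigma_2^{\mathcal V,\mathcal W}$ be the two largest singular values of $H^{\mathcal V,\mathcal W}[\mu](\mathrm i\omega)$. Closed balls are written $\overline{\mathcal B}(\cdot,\eta)$ (Euclidean norm). Because the data are real, $\sigma(\mu,-\omega)=\sigma(\mu,\omega)$. We say that $w\in\mathbb R$ is *the unique global maximizer of $\sigma(\mu,\cdot)$* if $\sigma(\mu,\omega)<\sigma(\mu,w)$ for every $\omega\in\mathbb R$ with $|\omega|\ne|w|$ and also $\lim_{|\omega|\to\infty}\sigma(\mu,\omega)<\sigma(\mu,w)$; that is, $w$ is unique on $\mathbb R\cup\{\infty\}$ up to its sign. **Algorithms.** Let $\underline\Omega\subseteq\Omega$ be compact. Both algorithms start with subspaces $\mathcal V_0,\mathcal W_0\subseteq\mathbb C^n$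 (possibly zero). In step $j=1,2,\dots$ they choose $\mu^{(j)}$ as a minimizer over $\mu\in\underline\Omega$ of $\sup_{\omega\in\mathbb R}\sigma^{\mathcal V_{j-1},\mathcal W_{j-1}}(\mu,\omega)$ (taken to be $+\infty$ where the reduced pencil is not regular), choose $\omega^{(j)}\in\mathbb R$ as a global maximizer of $\sigma(\mu^{(j)},\cdot)$, with $D(\mu^{(j)},\mathrm i\omega^{(j)})$ invertible, and add to $\mathcal V_{j-1}$ and $\mathcal W_{j-1}$ the column spaces of $\widetilde V(\mu^{(j)},\omega^{(j)})$ and $\widetilde W(\mu^{(j)},\omega^{(j)})$. Here, with all matrices evaluated at $(\mu,\mathrm i\omega)$, $\widetilde V(\mu,\omega)$ is $D^{-1}B$ if $m\le p$ and $D^{-1}BH^*$ if $m>p$, and $\widetilde W(\mu,\omega)$ is $D^{-*}C^*$ if $m\ge p$ and $D^{-*}C^*H$ if $m<p$. In the basic algorithm the results are $\mathcal V_j,\mathcal W_j$. The extended algorithm, for $j\ge2$, also adds the column spaces of $\widetilde V(\mu^{(j,rq)},\omega^{(j,rq)})$ and $\widetilde W(\mu^{(j,rq)},\omega^{(j,rq)})$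 for all $1\le r\le q\le d$, where $\mu^{(j,rq)}=\mu^{(j)}+\|\mu^{(j)}-\mu^{(j-1)}\|_2\,e_{rq}\in\Omega$, $e_{rr}=e_r$, $e_{rq}=(e_r+e_q)/\sqrt2$ for $r\neq q$, and $\omega^{(j,rq)}\in\mathbb R$ is a global maximizer of $\sigma(\mu^{(j,rq)},\cdot)$ with $D(\mu^{(j,rq)},\mathrm i\omega^{(j,rq)})$ invertible. In each step $\mathcal V_j$ and $\mathcal W_j$ are assumed to have equal dimension, and $V_j,W_j$ are matrices whose columns form orthonormal bases of them. **Assumptions.** $H[\mu]\in\mathcal H_\infty$ for all $\mu\in\underline\Omega$; $\mu_*\in\underline\Omega$ is a local (or global) minimizer of $\|H[\cdot]\|_{\mathcal H_\infty}$ over $\underline\Omega$; $H[\mu]\in\mathcal H_\infty$ for all $\mu$ in a neighbourhood of $\mu_*$; and $\sigma$, extended to $\omega=\infty$ by its limit, is continuous at all points of $\{\mu_*\}\times(\mathbb R\cup\{\infty\})$, that is, $\sigma(\mu,\cdot)\to\sigma(\mu_*,\cdot)$ uniformly on $\mathbb R$ as $\mu\to\mu_*$. (Smoothness) $\sigma(\mu_*,\cdot)$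 has the unique global maximizer $\omega_*\in\mathbb R$, and $\sigma(\mu_*,\omega_*)>0$ is a simple singular value of $H[\mu_*](\mathrm i\omega_*)$. Fix $k\ge1$ and an arbitrary family of runs of the two algorithms (through step $k$) for which $\mu^{(k)}\to\mu_*$ as $\mu^{(1)}\to\mu_*$ and, if $\omega_*\ne0$, the sign of $\omega^{(k)}$ is chosen such that $\omega^{(k)}\omega_*\ge0$. Finally let $\delta<0$ and $\beta>0$ with $\sigma_{\omega\omega}(\mu_*,\omega_*)\le\delta$ and $\sigma_{\min}(D(\mu_*,\mathrm i\omega_*))\ge\beta$. **Proposition.** There are $\rho,\eta_{\mu,0},\eta_{\omega,0},\varepsilon>0$, the same for all runs of the family, with $\overline{\mathcal B}(\mu_*,\eta_{\mu,0})\subseteq\Omega$, such that the following holds. Parts (i) and (iii) concern the full system only; (ii) and (iv) hold for each run of the family with $\|\mu^{(1)}-\mu_*\|_2<\rho$, $\sigma^{\mathcal V_k,\mathcal W_k}_{\omega\omega}(\mu_*,\omega_*)\le\delta$ and $\sigma_{\min}(D^{V_k,W_k}(\mu_*,\mathrm i\omega_*))\ge\beta$. (i) There is a unique continuous function $\boldsymbol\omega:\overline{\mathcal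 B}(\mu_*,\eta_{\mu,0})\to\overline{\mathcal B}(\omega_*,\eta_{\omega,0})$, three times continuously differentiable in the interior, with $\boldsymbol\omega(\mu_*)=\omega_*$ and $\sigma_\omega(\mu,\boldsymbol\omega(\mu))=0$ for all $\mu\in\overline{\mathcal B}(\mu_*,\eta_{\mu,0})$. Moreover, for all these $\mu$, $\sigma(\mu,\cdot)$ is twice continuously differentiable at $\boldsymbol\omega(\mu)$ and $\sigma_{\omega\omega}(\mu,\boldsymbol\omega(\mu))\le\delta/2$. (ii) $\mu^{(k)}\in\overline{\mathcal B}(\mu_*,\eta_{\mu,0})$, and there is a unique continuous function $\boldsymbol\omega^{\mathcal V_k,\mathcal W_k}:\overline{\mathcal B}(\mu_*,\eta_{\mu,0})\to\overline{\mathcal B}(\omega_*,\eta_{\omega,0})$, three times continuously differentiable in the interior, with $\boldsymbol\omega^{\mathcal V_k,\mathcal W_k}(\mu^{(k)})=\omega^{(k)}$ and $\sigma^{\mathcal V_k,\mathcal W_k}_\omega(\mu,\boldsymbol\omega^{\mathcal V_k,\mathcal W_k}(\mu))=0$ for all $\mu\in\overline{\mathcal B}(\mu_*,\eta_{\mu,0})$.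 Moreover, for all these $\mu$, $\sigma^{\mathcal V_k,\mathcal W_k}(\mu,\cdot)$ is twice continuously differentiable at $\boldsymbol\omega^{\mathcal V_k,\mathcal W_k}(\mu)$ and $\sigma^{\mathcal V_k,\mathcal W_k}_{\omega\omega}(\mu,\boldsymbol\omega^{\mathcal V_k,\mathcal W_k}(\mu))\le\delta/2$. (iii) For all $\mu\in\overline{\mathcal B}(\mu_*,\eta_{\mu,0})$: $\sigma(\mu,\boldsymbol\omega(\mu))-\sigma_2(\mu,\boldsymbol\omega(\mu))\ge\varepsilon$, the unique global maximizer of $\sigma(\mu,\cdot)$ is $\boldsymbol\omega(\mu)$ (and $\boldsymbol\omega(\mu)=0$ if $\omega_*=0$), and $\|H[\mu]\|_{\mathcal H_\infty}=\sigma(\mu,\boldsymbol\omega(\mu))$. (iv) For all $\mu\in\overline{\mathcal B}(\mu_*,\eta_{\mu,0})$: $\sigma^{\mathcal V_k,\mathcal W_k}(\mu,\boldsymbol\omega^{\mathcal V_k,\mathcal W_k}(\mu))-\sigma_2^{\mathcal V_k,\mathcal W_k}(\mu,\boldsymbol\omega^{\mathcal V_k,\mathcal W_k}(\mu))\ge\varepsilon$,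 and $\boldsymbol\omega^{\mathcal V_k,\mathcal W_k}(\mu)$ is the unique maximizer and the unique stationary point of $\sigma^{\mathcal V_k,\mathcal W_k}(\mu,\cdot)$ in $\overline{\mathcal B}(\omega_*,\eta_{\omega,0})$. -/

import Mathlib

open Set Filter Topology Metric
open scoped Matrix ENNReal

namespace HinfMin

noncomputable section

/-! ### Singular values of complex matrices -/

/-- The `i`-th largest singular value (counted from `0`, with multiplicity, with respect to the
Euclidean norms) of a complex matrix; it is `0` once the singular values are exhausted. -/
def sval {p m : ℕ} (M : Matrix (Fin p) (Fin m) ℂ) (i : ℕ) : ℝ :=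
  (Matrix.toEuclideanLin M).singularValues i

/-- The largest singular value, that is, the spectral norm. -/
def svalMax {p m : ℕ} (M : Matrix (Fin p) (Fin m) ℂ) : ℝ := sval M 0

/-- The second largest singular value. -/
def svalSecond {p m : ℕ} (M : Matrix (Fin p) (Fin m) ℂ) : ℝ := sval M 1

/-- The smallest singular value of a square matrix. -/
def svalMin {r : ℕ} (M : Matrix (Fin r) (Fin r) ℂ) : ℝ := sval M (r - 1)

/-! ### Transfer functions -/

/-- The pencil `s E - A` is regular. -/
def RegularPencil {r : ℕ} (E A : Matrix (Fin r) (Fin r) ℂ) : Prop :=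
  ∃ z : ℂ, (z • E - A).det ≠ 0

/-- The transfer function `C (s E - A)⁻¹ B`, as a matrix of rational functions of `s`. -/
def transfer {r m p : ℕ} (E A : Matrix (Fin r) (Fin r) ℂ) (B : Matrix (Fin r) (Fin m) ℂ)
    (C : Matrix (Fin p) (Fin r) ℂ) : Matrix (Fin p) (Fin m) (RatFunc ℂ) :=
  C.map RatFunc.C *
    ((RatFunc.X : RatFunc ℂ) • E.map RatFunc.C - A.map RatFunc.C)⁻¹ * B.map RatFunc.C

/-- The value at `s` of a matrix of rational functions; the entries are evaluated in lowest terms,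
so removable singularities are removed. -/
def evalAt {p m : ℕ} (H : Matrix (Fin p) (Fin m) (RatFunc ℂ)) (s : ℂ) :
    Matrix (Fin p) (Fin m) ℂ :=
  H.map (RatFunc.eval (RingHom.id ℂ) s)

/-- The column space of a matrix. -/
def col {n m : ℕ} (M : Matrix (Fin n) (Fin m) ℂ) : Submodule ℂ (Fin n → ℂ) :=
  LinearMap.range M.mulVecLin

/-- A real matrix, viewed as a complex one. -/
def cplx {p m : ℕ} (M : Matrix (Fin p) (Fin m) ℝ) : Matrix (Fin p) (Fin m) ℂ :=
  M.map (fun x : ℝ => (x : ℂ))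

/-! ### Parameter-dependent descriptor systems -/

/-- A descriptor system of order `n` with `m` inputs and `p` outputs that depends on `d` real
parameters through finitely many real-analytic coefficient functions on an open bounded set. -/
structure ParamSystem (d n m p : ℕ) where
  Ω : Set (EuclideanSpace ℝ (Fin d))
  isOpen_Ω : IsOpen Ω
  isBounded_Ω : Bornology.IsBounded Ω
  κE : ℕ
  κA : ℕ
  κB : ℕ
  κC : ℕ
  f : Fin κE → EuclideanSpace ℝ (Fin d) → ℝ
  g : Fin κA → EuclideanSpace ℝ (Fin d) → ℝ
  h : Fin κB → EuclideanSpace ℝ (Fin d) → ℝ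
  k : Fin κC → EuclideanSpace ℝ (Fin d) → ℝ
  analytic_f : ∀ i, AnalyticOnNhd ℝ (f i) Ω
  analytic_g : ∀ i, AnalyticOnNhd ℝ (g i) Ω
  analytic_h : ∀ i, AnalyticOnNhd ℝ (h i) Ω
  analytic_k : ∀ i, AnalyticOnNhd ℝ (k i) Ω
  matE : Fin κE → Matrix (Fin n) (Fin n) ℝ
  matA : Fin κA → Matrix (Fin n) (Fin n) ℝ
  matB : Fin κB → Matrix (Fin n) (Fin m) ℝ
  matC : Fin κC → Matrix (Fin p) (Fin n) ℝ

namespace ParamSystem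

variable {d n m p : ℕ} (S : ParamSystem d n m p)

/-! #### The full system -/

def E (μ : EuclideanSpace ℝ (Fin d)) : Matrix (Fin n) (Fin n) ℝ := ∑ i, S.f i μ • S.matE i

def A (μ : EuclideanSpace ℝ (Fin d)) : Matrix (Fin n) (Fin n) ℝ := ∑ i, S.g i μ • S.matA i

def B (μ : EuclideanSpace ℝ (Fin d)) : Matrix (Fin n) (Fin m) ℝ := ∑ i, S.h i μ • S.matB i

def C (μ : EuclideanSpace ℝ (Fin d)) : Matrix (Fin p) (Fin n) ℝ := ∑ i, S.k i μ • S.matC i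

/-- `D(μ, s) = s E(μ) - A(μ)`. -/
def D (μ : EuclideanSpace ℝ (Fin d)) (s : ℂ) : Matrix (Fin n) (Fin n) ℂ :=
  s • cplx (S.E μ) - cplx (S.A μ)

/-- The value `H[μ](s)` of the transfer function. -/
def H (μ : EuclideanSpace ℝ (Fin d)) (s : ℂ) : Matrix (Fin p) (Fin m) ℂ :=
  evalAt (transfer (cplx (S.E μ)) (cplx (S.A μ)) (cplx (S.B μ)) (cplx (S.C μ))) s

/-- `σ(μ, ω)`, the largest singular value of `H[μ](iω)`. -/
def sigma (μ : EuclideanSpace ℝ (Fin d)) (ω : ℝ) : ℝ := svalMax (S.H μ (Complex.I * ω))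

/-- `σ₂(μ, ω)`, the second largest singular value of `H[μ](iω)`. -/
def sigmaSecond (μ : EuclideanSpace ℝ (Fin d)) (ω : ℝ) : ℝ := svalSecond (S.H μ (Complex.I * ω))

/-- The supremum of `‖H[μ](s)‖₂` over the open right half-plane; near a pole the supremum
is infinite. -/
def hInfNorm (μ : EuclideanSpace ℝ (Fin d)) : ℝ≥0∞ :=
  ⨆ s : {s : ℂ // 0 < s.re}, ENNReal.ofReal (svalMax (S.H μ s))

/-- The transfer function `H[μ]` is defined and belongs to the Hardy space. -/
def InHinf (μ : EuclideanSpace ℝ (Fin d)) : Prop :=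
  RegularPencil (cplx (S.E μ)) (cplx (S.A μ)) ∧ S.hInfNorm μ < ⊤

/-! #### Reduced systems -/

section Reduced

variable {r : ℕ} (V W : Matrix (Fin n) (Fin r) ℂ)

def redE (μ : EuclideanSpace ℝ (Fin d)) : Matrix (Fin r) (Fin r) ℂ :=
  ∑ i, (S.f i μ : ℂ) • (Wᴴ * cplx (S.matE i) * V)

def redA (μ : EuclideanSpace ℝ (Fin d)) : Matrix (Fin r) (Fin r) ℂ :=
  ∑ i, (S.g i μ : ℂ) • (Wᴴ * cplx (S.matA i) * V)

def redB (μ : EuclideanSpace ℝ (Fin d)) : Matrix (Fin r) (Fin m) ℂ :=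
  ∑ i, (S.h i μ : ℂ) • (Wᴴ * cplx (S.matB i))

def redC (μ : EuclideanSpace ℝ (Fin d)) : Matrix (Fin p) (Fin r) ℂ :=
  ∑ i, (S.k i μ : ℂ) • (cplx (S.matC i) * V)

def redD (μ : EuclideanSpace ℝ (Fin d)) (s : ℂ) : Matrix (Fin r) (Fin r) ℂ :=
  s • S.redE V W μ - S.redA V W μ

def redH (μ : EuclideanSpace ℝ (Fin d)) (s : ℂ) : Matrix (Fin p) (Fin m) ℂ :=
  evalAt (transfer (S.redE V W μ) (S.redA V W μ) (S.redB W μ) (S.redC V μ)) s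

def redSigma (μ : EuclideanSpace ℝ (Fin d)) (ω : ℝ) : ℝ :=
  svalMax (S.redH V W μ (Complex.I * ω))

def redSigmaSecond (μ : EuclideanSpace ℝ (Fin d)) (ω : ℝ) : ℝ :=
  svalSecond (S.redH V W μ (Complex.I * ω))

open Classical in
/-- The norm minimized by the algorithms: the supremum over the imaginary axis, since reduced
systems need not be stable. It is infinite where the reduced transfer function is undefined. -/
def redNorm (μ : EuclideanSpace ℝ (Fin d)) : ℝ≥0∞ :=
  if RegularPencil (S.redE V W μ) (S.redA V W μ) then
    ⨆ ω : ℝ, ENNReal.ofReal (S.redSigma V W μ ω)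
  else ⊤

end Reduced

/-! #### The interpolation subspaces of the algorithms -/

/-- `Col(D(μ,iω)⁻¹ B(μ))` if `m ≤ p`, and `Col(D(μ,iω)⁻¹ B(μ) H[μ](iω)*)` if `m > p`. -/
def newV (μ : EuclideanSpace ℝ (Fin d)) (ω : ℝ) : Submodule ℂ (Fin n → ℂ) :=
  if m ≤ p then col ((S.D μ (Complex.I * ω))⁻¹ * cplx (S.B μ))
  else col ((S.D μ (Complex.I * ω))⁻¹ * cplx (S.B μ) * (S.H μ (Complex.I * ω))ᴴ)

/-- `Col(D(μ,iω)⁻* C(μ)*)` if `m ≥ p`, and `Col(D(μ,iω)⁻* C(μ)* H[μ](iω))` if `m < p`. -/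
def newW (μ : EuclideanSpace ℝ (Fin d)) (ω : ℝ) : Submodule ℂ (Fin n → ℂ) :=
  if p ≤ m then col (((S.D μ (Complex.I * ω))⁻¹)ᴴ * (cplx (S.C μ))ᴴ)
  else col (((S.D μ (Complex.I * ω))⁻¹)ᴴ * (cplx (S.C μ))ᴴ * S.H μ (Complex.I * ω))

/-- `ω` is a (finite) global maximizer of `σ(μ, ·)` at which the interpolation subspaces can be
formed. As the value of `σ(μ, ·)` at infinity is a limit, a finite maximizer over the real
line is a maximizer over the real line with infinity added. -/
def IsPeak (μ : EuclideanSpace ℝ (Fin d)) (ω : ℝ) : Prop :=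
  (∀ ω', S.sigma μ ω' ≤ S.sigma μ ω) ∧ IsUnit (S.D μ (Complex.I * ω)).det

end ParamSystem

/-! ### Runs of the algorithms -/

/-- The quantities that a run of one of the algorithms produces. The columns of `V j` and `W j`
form bases of the `j`-th pair of subspaces (which therefore have the same dimension `r j`); `V 0`,
`W 0` are the initial ones. The iterates are `μ j`, `ω j` for `j ≥ 1`, and `ωadj j a b` are the
frequencies used at the additional points of the extended algorithm. -/
structure Run (d n : ℕ) where
  r : ℕ → ℕ
  V : (j : ℕ) → Matrix (Fin n) (Fin (r j)) ℂ
  W : (j : ℕ) → Matrix (Fin n) (Fin (r j)) ℂ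
  μ : ℕ → EuclideanSpace ℝ (Fin d)
  ω : ℕ → ℝ
  ωadj : ℕ → Fin d → Fin d → ℝ

/-- `e_a` if `a = b` and `(e_a + e_b) / √2` otherwise. -/
def adjDir {d : ℕ} (a b : Fin d) : EuclideanSpace ℝ (Fin d) :=
  if a = b then EuclideanSpace.single a 1
  else (1 / √2 : ℝ) • (EuclideanSpace.single a 1 + EuclideanSpace.single b 1)

namespace Run

variable {d n : ℕ} (R : Run d n)

/-- The additional points `μ^(j) + ‖μ^(j) - μ^(j-1)‖ e_ab` of the extended algorithm. -/
def μadj (j : ℕ) (a b : Fin d) : EuclideanSpace ℝ (Fin d) :=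
  R.μ j + ‖R.μ j - R.μ (j - 1)‖ • adjDir a b

variable {m p : ℕ} (S : ParamSystem d n m p) (K : Set (EuclideanSpace ℝ (Fin d)))

/-- The columns of `V j` and of `W j` are orthonormal. -/
def Orthonormal (j : ℕ) : Prop := (R.V j)ᴴ * R.V j = 1 ∧ (R.W j)ᴴ * R.W j = 1

/-- The choice of the iterates at step `j ≥ 1`: `μ^(j)` minimizes the norm of the previous reduced
system over `K`, and `ω^(j)` maximizes `σ(μ^(j), ·)`. -/
def Selects (j : ℕ) : Prop :=
  R.μ j ∈ K ∧
  (∀ μ' ∈ K, S.redNorm (R.V (j - 1)) (R.W (j - 1)) (R.μ j) ≤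
    S.redNorm (R.V (j - 1)) (R.W (j - 1)) μ') ∧
  S.IsPeak (R.μ j) (R.ω j)

/-- The first `k` steps of `R` are steps of the basic greedy algorithm for the minimization of the
norm of the system `S` over `K`. -/
def IsBasic (k : ℕ) : Prop :=
  (∀ j ≤ k, R.Orthonormal j) ∧
  ∀ j, 1 ≤ j → j ≤ k →
    R.Selects S K j ∧
    col (R.V j) = col (R.V (j - 1)) ⊔ S.newV (R.μ j) (R.ω j) ∧
    col (R.W j) = col (R.W (j - 1)) ⊔ S.newW (R.μ j) (R.ω j)

/-- The first `k` steps of `R` are steps of the extended greedy algorithm for the minimization of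
the norm of the system `S` over `K`: from the second step on, the subspaces are also enlarged at
the additional points. -/
def IsExtended (k : ℕ) : Prop :=
  (∀ j ≤ k, R.Orthonormal j) ∧
  ∀ j, 1 ≤ j → j ≤ k →
    R.Selects S K j ∧
    (2 ≤ j → ∀ a b, a ≤ b →
      R.μadj j a b ∈ S.Ω ∧ S.IsPeak (R.μadj j a b) (R.ωadj j a b)) ∧
    col (R.V j) = col (R.V (j - 1)) ⊔ S.newV (R.μ j) (R.ω j) ⊔
      (⨆ (_ : 2 ≤ j) (a) (b) (_ : a ≤ b), S.newV (R.μadj j a b) (R.ωadj j a b)) ∧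
    col (R.W j) = col (R.W (j - 1)) ⊔ S.newW (R.μ j) (R.ω j) ⊔
      (⨆ (_ : 2 ≤ j) (a) (b) (_ : a ≤ b), S.newW (R.μadj j a b) (R.ωadj j a b))

end Run

/-! ### Maximizers and stationary branches -/

/-- The supremum of the even function `s` over the real line with infinity added is attained at
`w` and, apart from the mirror image `-w`, nowhere else; `s` has a limit at infinity in the cases
of interest, so the second clause says that this limit is smaller than `s w`. -/
def IsUniqueMax (s : ℝ → ℝ) (w : ℝ) : Prop :=
  (∀ ω, |ω| ≠ |w| → s ω < s w) ∧ ∃ c < s w, ∀ᶠ ω in cocompact ℝ, s ω ≤ c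

/-- On the closed ball of radius `a` about `μs`, the function `w` is continuous with values in
the closed interval of radius `b` about `ωs`, three times continuously differentiable in the
interior, takes the value `ω₀` at the point `μ₀` of the ball, and `w μ` is a stationary point
of `s μ` for each `μ`. -/
structure IsStationaryBranch {d : ℕ} (s : EuclideanSpace ℝ (Fin d) → ℝ → ℝ)
    (μs : EuclideanSpace ℝ (Fin d)) (ωs a b : ℝ) (μ₀ : EuclideanSpace ℝ (Fin d)) (ω₀ : ℝ)
    (w : EuclideanSpace ℝ (Fin d) → ℝ) : Prop where
  continuousOn : ContinuousOn w (closedBall μs a)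
  mapsTo : MapsTo w (closedBall μs a) (closedBall ωs b)
  contDiffOn : ContDiffOn ℝ 3 w (ball μs a)
  mem_base : μ₀ ∈ closedBall μs a
  eq_base : w μ₀ = ω₀
  stationary : ∀ μ ∈ closedBall μs a, HasDerivAt (s μ) 0 (w μ)

/-- `w` is the only stationary branch, up to its irrelevant values outside the ball. -/
def IsUniqueStationaryBranch {d : ℕ} (s : EuclideanSpace ℝ (Fin d) → ℝ → ℝ)
    (μs : EuclideanSpace ℝ (Fin d)) (ωs a b : ℝ) (μ₀ : EuclideanSpace ℝ (Fin d)) (ω₀ : ℝ)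
    (w : EuclideanSpace ℝ (Fin d) → ℝ) : Prop :=
  IsStationaryBranch s μs ωs a b μ₀ ω₀ w ∧
  ∀ w', IsStationaryBranch s μs ωs a b μ₀ ω₀ w' → EqOn w' w (closedBall μs a)

/-- `s` is twice continuously differentiable at `ω` with second derivative at most `c`. -/
def SecondDerivLE (s : ℝ → ℝ) (ω c : ℝ) : Prop :=
  ContDiffAt ℝ 2 s ω ∧ deriv (deriv s) ω ≤ c

end

end HinfMin

open HinfMin

open HinfMin

namespace HinfMin

/-! ### Uniform families of stationary branches -/

section Branch

/-! The constants must be the same for all runs, and this uniformity comes from compactness in the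
projection matrices. The value `σ^{V,W}(μ, ω)` is treated as a function of all of `(V, W, μ, ω)`. It
is smooth where the reduced pencil is invertible and the largest singular value is simple, since its
square is then a simple root of a characteristic polynomial (`contDiffAt_svalMax`). Let `g` be the
gap between the two largest singular values of the full system at `(μ_*, ω_*)`. The pairs `(V, W)`
with orthonormal columns whose reduced system has, at `(μ_*, ω_*)`, a pencil bounded below by `β`, a
gap of at least `g/2` and a second derivative of at most `δ` form a compact set for each size `r ≤
n` (`isCompact_peakedPairs`). Over such a set the derivative in `ω` decreases with slope at most
`δ/2` on one common box, so a stationary point close to the base point continues to a unique branch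
of local maximizers, with radii common to all members (`exists_uniform_branch`). The full system is
the member `V = W = 1`, so the full and the reduced branches come from the same lemma.

It remains to place a run in this compact set and to find its stationary point. Neither the gap of
the reduced system at the base point nor stationarity at `ω^(k)` is assumed; both follow from
interpolation at `(μ^(k), ω^(k))`. The two transfer functions agree there (`redH_eq_H`), hence so do
the gaps, and on a common box the gap of every pair with stable pencil varies by less than `g/4`
(`eventually_redGap_near`). For stationarity, freeze the singular vectors `u, v` of the full system
at its peak. The function `Re u*H(iω)v` lies below `σ` and touches it at the maximum, so its
derivative vanishes; the reduced pairing has the same derivative, lies below the reduced `σ` and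
touches it at the same point (`hasDerivAt_redSigma_of_isPeak`).

Finally, the unique maximum at `μ_*` and uniform convergence keep global maximizers near `±ω_*`.
This puts `ω^(k)` close to `ω_*` and, with evenness, makes the local maximizers of the full system
global. The Phragmén–Lindelöf principle identifies the Hardy norm with the maximum on the imaginary
axis. -/

theorem hasDerivAt_snd {X : Type*} [NormedAddCommGroup X] [NormedSpace ℝ X]
    {F : X × ℝ → ℝ} {z : X × ℝ} (h : DifferentiableAt ℝ F z) :
    HasDerivAt (fun t => F (z.1, t)) (fderiv ℝ F z (0, 1)) z.2 := by
  have h1 : HasFDerivAt F (fderiv ℝ F z) ((fun t : ℝ => (z.1, t)) z.2) := h.hasFDerivAt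
  have h2 : HasDerivAt (fun t : ℝ => (z.1, t)) ((0 : X), (1 : ℝ)) z.2 :=
    (hasDerivAt_const _ _).prodMk (hasDerivAt_id _)
  exact h1.comp_hasDerivAt _ h2

theorem isInvertible_fderiv_inr {X : Type*} [NormedAddCommGroup X] [NormedSpace ℝ X]
    {F : X × ℝ → ℝ} {z : X × ℝ} (h : DifferentiableAt ℝ F z)
    (hne : deriv (fun t => F (z.1, t)) z.2 ≠ 0) :
    (fderiv ℝ F z ∘L ContinuousLinearMap.inr ℝ X ℝ).IsInvertible := by
  have hc : fderiv ℝ F z (0, 1) ≠ 0 := by rw [← (hasDerivAt_snd h).deriv]; exact hne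
  refine ⟨ContinuousLinearEquiv.unitsEquivAut ℝ (Units.mk0 _ hc), ?_⟩
  ext
  simp

theorem contDiffAt_deriv_snd {X : Type*} [NormedAddCommGroup X] [NormedSpace ℝ X]
    {F : X × ℝ → ℝ} {z : X × ℝ} {n : ℕ} (h : ContDiffAt ℝ (n + 1) F z) :
    ContDiffAt ℝ n (fun y : X × ℝ => deriv (fun t => F (y.1, t)) y.2) z := by
  have h1 : ContDiffAt ℝ n (fun y => fderiv ℝ F y (0, 1)) z :=
    (h.fderiv_right le_rfl).clm_apply contDiffAt_const
  refine h1.congr_of_eventuallyEq ?_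
  have h2 := h.eventually (by exact_mod_cast (ENat.natCast_ne_top (n + 1)))
  filter_upwards [h2] with y hy
  exact (hasDerivAt_snd (hy.differentiableAt (by simp))).deriv

theorem exists_box_of_eventually {M : Type*} [PseudoMetricSpace M] {x : M} {y : ℝ}
    {p : M × ℝ → Prop} :
    (∀ᶠ z in 𝓝 (x, y), p z) →
    ∃ r > 0, ∀ μ ∈ closedBall x r, ∀ ω ∈ closedBall y r, p (μ, ω) := by
  intro h
  rw [(nhds_basis_closedBall (x := (x, y))).eventually_iff] at h
  obtain ⟨r, hr, h⟩ := h
  refine ⟨r, hr, fun μ hμ ω hω => h ?_⟩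
  rw [← closedBall_prod_same]
  exact ⟨hμ, hω⟩

theorem isStrictMax_of_deriv {f : ℝ → ℝ} {s : Set ℝ} (hs : Convex ℝ s) {w : ℝ} (hw : w ∈ s)
    (hf : ∀ x ∈ s, DifferentiableAt ℝ f x) (hanti : StrictAntiOn (deriv f) s)
    (h0 : deriv f w = 0) : ∀ x ∈ s, x ≠ w → f x < f w := by
  intro x hx hxw
  rcases lt_or_gt_of_ne hxw with h | h
  · have hsub : Icc x w ⊆ s := hs.ordConnected.out hx hw
    refine strictMonoOn_of_deriv_pos (convex_Icc x w)
      (fun y hy => (hf y (hsub hy)).continuousAt.continuousWithinAt) (fun y hy => ?_)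
      (left_mem_Icc.2 h.le) (right_mem_Icc.2 h.le) h
    rw [interior_Icc] at hy
    rw [← h0]
    exact hanti (hsub ⟨hy.1.le, hy.2.le⟩) hw hy.2
  · have hsub : Icc w x ⊆ s := hs.ordConnected.out hw hx
    refine strictAntiOn_of_deriv_neg (convex_Icc w x)
      (fun y hy => (hf y (hsub hy)).continuousAt.continuousWithinAt) (fun y hy => ?_)
      (left_mem_Icc.2 h.le) (right_mem_Icc.2 h.le) h
    rw [interior_Icc] at hy
    rw [← h0]
    exact hanti hw (hsub ⟨hy.1.le, hy.2.le⟩) hy.1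

/-- A zero set that is the graph of a function inherits the smoothness of the equation. -/
theorem contDiffWithinAt_of_unique_zero {M : Type*} [NormedAddCommGroup M] [NormedSpace ℝ M]
    [CompleteSpace M] {h : M × ℝ → ℝ} {n : WithTop ℕ∞} (hn : n ≠ 0) {s : Set M} {w : M → ℝ}
    {x : M} (hh : ContDiffAt ℝ n h (x, w x))
    (hne : deriv (fun t => h (x, t)) (w x) ≠ 0) (hzero : h (x, w x) = 0)
    {I : Set ℝ} (hI : I ∈ 𝓝 (w x)) (huniq : ∀ y ∈ s, ∀ t ∈ I, h (y, t) = 0 → t = w y) :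
    ContDiffWithinAt ℝ n w s x := by
  have hinv := isInvertible_fderiv_inr (hh.differentiableAt hn) hne
  set ψ := hh.implicitFunction hn hinv with hψ
  have hψC : ContDiffAt ℝ n ψ x := hh.contDiffAt_implicitFunction hn hinv
  have hψx : ψ x = w x := hh.implicitFunction_apply_self hn hinv
  have hev : ∀ᶠ y in 𝓝 x, h (y, ψ y) = h (x, w x) := hh.eventually_apply_implicitFunction hn hinv
  have hmem : ∀ᶠ y in 𝓝 x, ψ y ∈ I := hψC.continuousAt (by rw [hψx]; exact hI)
  -- The implicit function stays in `I` near `x`, so uniqueness of the zero forces it to equal `w`;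
  -- no continuity of `w` is needed beforehand.
  refine hψC.contDiffWithinAt.congr_of_eventuallyEq ?_ hψx.symm
  filter_upwards [hev.filter_mono nhdsWithin_le_nhds, hmem.filter_mono nhdsWithin_le_nhds,
    self_mem_nhdsWithin] with y h1 h2 h3
  exact (huniq y h3 _ h2 (h1.trans hzero)).symm

/-- A stationary point of a member of a compact family of functions, each with negative second
derivative at the base point, extends to a unique stationary branch over a ball whose
radius does not depend on the member. -/
theorem exists_uniform_branch {Q : Type*} [NormedAddCommGroup Q] [NormedSpace ℝ Q] {d : ℕ}
    (F : Q → EuclideanSpace ℝ (Fin d) → ℝ → ℝ) {P : Set Q} (hP : IsCompact P)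
    (μs : EuclideanSpace ℝ (Fin d)) (ωs δ : ℝ) (hδ : δ < 0)
    (hF : ∀ q ∈ P, ContDiffAt ℝ 4
      (fun z : (Q × EuclideanSpace ℝ (Fin d)) × ℝ => F z.1.1 z.1.2 z.2) ((q, μs), ωs))
    (h2 : ∀ q ∈ P, deriv (deriv (F q μs)) ωs ≤ δ) :
    ∀ᶠ b in 𝓝[>] (0 : ℝ), ∀ᶠ a in 𝓝[>] (0 : ℝ), ∀ q ∈ P, ∀ μ₀ ∈ closedBall μs a,
      ∀ ω₀ ∈ closedBall ωs (b / 2), HasDerivAt (F q μ₀) 0 ω₀ →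
      ∃ w, IsUniqueStationaryBranch (F q) μs ωs a b μ₀ ω₀ w ∧
        ∀ μ ∈ closedBall μs a, SecondDerivLE (F q μ) (w μ) (δ / 2) ∧
          (∀ ω ∈ closedBall ωs b, ω ≠ w μ → F q μ ω < F q μ (w μ)) ∧
          ∀ ω ∈ closedBall ωs b, HasDerivAt (F q μ) 0 ω → ω = w μ := by
  set U : (Q × EuclideanSpace ℝ (Fin d)) × ℝ → ℝ := fun z => F z.1.1 z.1.2 z.2 with hU
  set U1 : (Q × EuclideanSpace ℝ (Fin d)) × ℝ → ℝ := fun z => deriv (F z.1.1 z.1.2) z.2 with hU1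
  set U2 : (Q × EuclideanSpace ℝ (Fin d)) × ℝ → ℝ :=
    fun z => deriv (deriv (F z.1.1 z.1.2)) z.2 with hU2
  have hC1 : ∀ z, ContDiffAt ℝ 4 U z → ContDiffAt ℝ 3 U1 z := fun z hz =>
    contDiffAt_deriv_snd (n := 3) (F := U) (by convert hz using 1; norm_num)
  have hC2 : ∀ z, ContDiffAt ℝ 4 U z → ContDiffAt ℝ 2 U2 z := fun z hz =>
    contDiffAt_deriv_snd (n := 2) (F := U1) (by convert hC1 z hz using 1; norm_num)
  -- uniform regularity
  have hgood : ∃ r > 0, ∀ μ ∈ closedBall μs r, ∀ ω ∈ closedBall ωs r, ∀ q ∈ P,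
      ContDiffAt ℝ 4 U ((q, μ), ω) ∧ U2 ((q, μ), ω) < δ / 2 := by
    refine exists_box_of_eventually (p := fun z => ∀ q ∈ P,
      ContDiffAt ℝ 4 U ((q, z.1), z.2) ∧ U2 ((q, z.1), z.2) < δ / 2) ?_
    -- Compactness of `P` turns a neighbourhood for each `q` into one box in `(μ, ω)` valid for all
    -- `q`.
    refine hP.eventually_forall_of_forall_eventually (P := fun (z : EuclideanSpace ℝ (Fin d) × ℝ) (q : Q) =>
      ContDiffAt ℝ 4 U ((q, z.1), z.2) ∧ U2 ((q, z.1), z.2) < δ / 2) fun q hq => ?_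
    have hcont : ContinuousAt (fun y : (EuclideanSpace ℝ (Fin d) × ℝ) × Q => ((y.2, y.1.1), y.1.2))
      ((μs, ωs), q) := by fun_prop
    have e1 : ∀ᶠ z in 𝓝 ((q, μs), ωs), ContDiffAt ℝ 4 U z :=
      (hF q hq).eventually (by decide)
    have e2 : ∀ᶠ z in 𝓝 ((q, μs), ωs), U2 z < δ / 2 :=
      (hC2 _ (hF q hq)).continuousAt.eventually_lt continuousAt_const
        (lt_of_le_of_lt (h2 q hq) (by linarith))
    exact hcont.eventually (e1.and e2)
  obtain ⟨r, hr, hgood⟩ := hgood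
  have hbr : ∀ᶠ b in 𝓝[>] (0 : ℝ), b ≤ r := (Iic_mem_nhds hr |> mem_nhdsWithin_of_mem_nhds)
  filter_upwards [hbr, self_mem_nhdsWithin] with b hb hb0
  rw [mem_Ioi] at hb0
  have hbsub : closedBall ωs b ⊆ closedBall ωs r := closedBall_subset_closedBall hb
  -- uniform variation of the first derivative
  have hvar : ∀ᶠ μ in 𝓝 μs, ∀ y ∈ P ×ˢ closedBall ωs b,
      |U1 ((y.1, μ), y.2) - U1 ((y.1, μs), y.2)| < -δ * b / 16 := by
    refine (hP.prod (isCompact_closedBall ωs b)).eventually_forall_of_forall_eventually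
      (P := fun μ y => |U1 ((y.1, μ), y.2) - U1 ((y.1, μs), y.2)| < -δ * b / 16) fun y hy => ?_
    have hc := (hC1 _ (hgood μs (mem_closedBall_self hr.le) y.2 (hbsub hy.2) y.1 hy.1).1).continuousAt
    have c1 : ContinuousAt (fun z : EuclideanSpace ℝ (Fin d) × (Q × ℝ) => U1 ((z.2.1, z.1), z.2.2))
        (μs, y) := ContinuousAt.comp (f := fun z : EuclideanSpace ℝ (Fin d) × (Q × ℝ) =>
          ((z.2.1, z.1), z.2.2)) (x := (μs, y)) hc (by fun_prop)
    have c2 : ContinuousAt (fun z : EuclideanSpace ℝ (Fin d) × (Q × ℝ) => U1 ((z.2.1, μs), z.2.2))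
        (μs, y) := ContinuousAt.comp (f := fun z : EuclideanSpace ℝ (Fin d) × (Q × ℝ) =>
          ((z.2.1, μs), z.2.2)) (x := (μs, y)) hc (by fun_prop)
    refine (c1.sub c2).abs.eventually_lt continuousAt_const ?_
    have := mul_pos (neg_pos.2 hδ) hb0
    rw [Pi.sub_apply, sub_self, abs_zero]
    linarith
  obtain ⟨r', hr', hvar⟩ := (nhds_basis_closedBall (x := μs)).eventually_iff.1 hvar
  have har : ∀ᶠ a in 𝓝[>] (0 : ℝ), a ≤ r := (Iic_mem_nhds hr |> mem_nhdsWithin_of_mem_nhds)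
  have har' : ∀ᶠ a in 𝓝[>] (0 : ℝ), a ≤ r' := (Iic_mem_nhds hr' |> mem_nhdsWithin_of_mem_nhds)
  filter_upwards [har, har', self_mem_nhdsWithin] with a ha ha' ha0 q hq μ₀ hμ₀ ω₀ hω₀ hst
  rw [mem_Ioi] at ha0
  have hasub : closedBall μs a ⊆ closedBall μs r := closedBall_subset_closedBall ha
  have hasub' : closedBall μs a ⊆ closedBall μs r' := closedBall_subset_closedBall ha'
  have hIcc : closedBall ωs b = Icc (ωs - b) (ωs + b) := Real.closedBall_eq_Icc
  have hreg : ∀ μ ∈ closedBall μs a, ∀ ω ∈ closedBall ωs b,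
      ContDiffAt ℝ 4 U ((q, μ), ω) ∧ U2 ((q, μ), ω) < δ / 2 := fun μ hμ ω hω =>
    hgood μ (hasub hμ) ω (hbsub hω) q hq
  have hdiff1 : ∀ μ ∈ closedBall μs a, ∀ ω ∈ closedBall ωs b, DifferentiableAt ℝ (F q μ) ω := by
    intro μ hμ ω hω
    exact (hasDerivAt_snd (F := U)
      ((hreg μ hμ ω hω).1.differentiableAt (by norm_num))).differentiableAt
  have hdiff2 : ∀ μ ∈ closedBall μs a, ∀ ω ∈ closedBall ωs b,
      DifferentiableAt ℝ (deriv (F q μ)) ω := by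
    intro μ hμ ω hω
    exact (hasDerivAt_snd (F := U1)
      ((hC1 _ (hreg μ hμ ω hω).1).differentiableAt (by norm_num))).differentiableAt
  have hcontD : ∀ μ ∈ closedBall μs a, ContinuousOn (deriv (F q μ)) (closedBall ωs b) :=
    fun μ hμ ω hω => (hdiff2 μ hμ ω hω).continuousAt.continuousWithinAt
  have hslope : ∀ μ ∈ closedBall μs a, ∀ x ∈ closedBall ωs b, ∀ y ∈ closedBall ωs b, x ≤ y →
      deriv (F q μ) y - deriv (F q μ) x ≤ δ / 2 * (y - x) := by
    intro μ hμ
    refine (convex_closedBall ωs b).image_sub_le_mul_sub_of_deriv_le (hcontD μ hμ) ?_ ?_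
    · exact fun x hx => (hdiff2 μ hμ x (interior_subset hx)).differentiableWithinAt
    · exact fun x hx => (hreg μ hμ x (interior_subset hx)).2.le
  have hanti : ∀ μ ∈ closedBall μs a, StrictAntiOn (deriv (F q μ)) (closedBall ωs b) := by
    intro μ hμ x hx y hy hxy
    have := hslope μ hμ x hx y hy hxy.le
    nlinarith
  have hvar2 : ∀ μ ∈ closedBall μs a, ∀ ω ∈ closedBall ωs b,
      |deriv (F q μ) ω - deriv (F q μ₀) ω| < -δ * b / 8 := by
    intro μ hμ ω hω
    have e1 := abs_lt.1 (hvar (hasub' hμ) (q, ω) ⟨hq, hω⟩)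
    have e2 := abs_lt.1 (hvar (hasub' hμ₀) (q, ω) ⟨hq, hω⟩)
    simp only [hU1] at e1 e2
    rw [abs_lt]
    constructor <;> linarith [e1.1, e1.2, e2.1, e2.2]
  have hω₀I : ω₀ ∈ Icc (ωs - b / 2) (ωs + b / 2) := by rwa [← Real.closedBall_eq_Icc]
  have hω₀b : ω₀ ∈ closedBall ωs b := closedBall_subset_closedBall (by linarith) hω₀
  have hl : ωs - b ∈ closedBall ωs b := by rw [hIcc]; constructor <;> linarith
  have hrr : ωs + b ∈ closedBall ωs b := by rw [hIcc]; constructor <;> linarith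
  -- Since `ω₀` is at least `b/2` away from the endpoint, slope at most `δ/2` makes the derivative
  -- at `μ₀` at most `δ b / 4` there. Passing from `μ₀` to `μ` changes it by less than half of that,
  -- so the sign survives.
  have hright : ∀ μ ∈ closedBall μs a, deriv (F q μ) (ωs + b) < 0 := by
    intro μ hμ
    have e1 := hslope μ₀ hμ₀ ω₀ hω₀b _ hrr (by linarith [hω₀I.2])
    rw [hst.deriv] at e1
    have e2 := abs_lt.1 (hvar2 μ hμ _ hrr)
    nlinarith [e2.1, e2.2, hω₀I.2, hω₀I.1]
  have hleft : ∀ μ ∈ closedBall μs a, 0 < deriv (F q μ) (ωs - b) := by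
    intro μ hμ
    have e1 := hslope μ₀ hμ₀ _ hl ω₀ hω₀b (by linarith [hω₀I.1])
    rw [hst.deriv] at e1
    have e2 := abs_lt.1 (hvar2 μ hμ _ hl)
    nlinarith [e2.1, e2.2, hω₀I.2, hω₀I.1]
  have hex : ∀ μ ∈ closedBall μs a, ∃ ω ∈ Ioo (ωs - b) (ωs + b), deriv (F q μ) ω = 0 := by
    intro μ hμ
    have hc := hcontD μ hμ
    rw [hIcc] at hc
    obtain ⟨ω, hω, h0⟩ := intermediate_value_Ioo' (by linarith) hc ⟨hright μ hμ, hleft μ hμ⟩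
    exact ⟨ω, hω, h0⟩
  -- The branch is chosen pointwise, without continuity; its smoothness is recovered from uniqueness
  -- of the zero. That the zeros lie in the open interval makes the closed one a neighbourhood of
  -- each of them.
  choose! w hwI hw0 using hex
  have hwb : ∀ μ ∈ closedBall μs a, w μ ∈ closedBall ωs b := fun μ hμ => by
    rw [hIcc]; exact Ioo_subset_Icc_self (hwI μ hμ)
  have huniq : ∀ μ ∈ closedBall μs a, ∀ ω ∈ closedBall ωs b, deriv (F q μ) ω = 0 → ω = w μ :=
    fun μ hμ ω hω h0 => (hanti μ hμ).injOn hω (hwb μ hμ) (h0.trans (hw0 μ hμ).symm)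
  have hsmooth : ContDiffOn ℝ 3 w (closedBall μs a) := by
    intro μ hμ
    have hreg' := hreg μ hμ _ (hwb μ hμ)
    refine contDiffWithinAt_of_unique_zero (h := fun z => deriv (F q z.1) z.2) (by norm_num) ?_
      ?_ (hw0 μ hμ) (I := closedBall ωs b) ?_ (fun y hy t ht => huniq y hy t ht)
    · exact ContDiffAt.comp (g := U1) (f := fun z : EuclideanSpace ℝ (Fin d) × ℝ => ((q, z.1), z.2))
        (μ, w μ) (hC1 _ hreg'.1) (by fun_prop)
    · have := hreg'.2
      simp only [hU2] at this
      exact ne_of_lt (lt_trans this (by linarith))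
    · rw [hIcc]; exact Icc_mem_nhds (hwI μ hμ).1 (hwI μ hμ).2
  refine ⟨w, ⟨⟨hsmooth.continuousOn, hwb, hsmooth.mono ball_subset_closedBall, hμ₀, ?_, ?_⟩, ?_⟩, ?_⟩
  · exact (huniq μ₀ hμ₀ ω₀ hω₀b hst.deriv).symm
  · intro μ hμ
    rw [← hw0 μ hμ]
    exact (hdiff1 μ hμ _ (hwb μ hμ)).hasDerivAt
  · intro w' hw' μ hμ
    exact huniq μ hμ _ (hw'.mapsTo hμ) (hw'.stationary μ hμ).deriv
  · intro μ hμ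
    have hreg' := hreg μ hμ _ (hwb μ hμ)
    refine ⟨⟨?_, hreg'.2.le⟩, ?_, fun ω hω h => huniq μ hμ ω hω h.deriv⟩
    · exact (ContDiffAt.comp (g := U) (f := fun t : ℝ => ((q, μ), t))
        (w μ) hreg'.1 (by fun_prop)).of_le (by norm_num)
    · exact isStrictMax_of_deriv (convex_closedBall ωs b) (hwb μ hμ) (hdiff1 μ hμ) (hanti μ hμ)
        (hw0 μ hμ)

end Branch

/-! ### Singular values: variational characterization and perturbation -/

section SingularValues

open LinearMap

variable {E F : Type*} [NormedAddCommGroup E] [InnerProductSpace ℂ E] [FiniteDimensional ℂ E]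
  [NormedAddCommGroup F] [InnerProductSpace ℂ F] [FiniteDimensional ℂ F]

/-- Parseval in an orthonormal eigenbasis of `T*T`, whose eigenvalues are the squared singular
values. -/
theorem norm_sq_apply_eq_sum (T : E →ₗ[ℂ] F) {n : ℕ} (hn : Module.finrank ℂ E = n) (x : E) :
    ‖T x‖ ^ 2 = ∑ i : Fin n, T.singularValues i ^ 2 *
      ‖inner ℂ (T.isSymmetric_adjoint_comp_self.eigenvectorBasis hn i) x‖ ^ 2 := by
  set b := T.isSymmetric_adjoint_comp_self.eigenvectorBasis hn with hb
  have h1 : inner ℂ x ((adjoint T ∘ₗ T) x) = ((‖T x‖ ^ 2 : ℝ) : ℂ) := by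
    rw [comp_apply, adjoint_inner_right, inner_self_eq_norm_sq_to_K]; norm_cast
  have h2 : ∀ i, inner ℂ (b i) ((adjoint T ∘ₗ T) x) =
      ((T.singularValues i ^ 2 : ℝ) : ℂ) * inner ℂ (b i) x := by
    intro i
    rw [← T.isSymmetric_adjoint_comp_self, hb,
      T.isSymmetric_adjoint_comp_self.apply_eigenvectorBasis hn, inner_smul_left,
      T.sq_singularValues_fin hn]
    simp
  rw [← b.sum_inner_mul_inner] at h1
  simp_rw [h2] at h1
  have h3 : ∀ i, inner ℂ x (b i) * (((T.singularValues i ^ 2 : ℝ) : ℂ) * inner ℂ (b i) x) =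
      ((T.singularValues i ^ 2 * ‖inner ℂ (b i) x‖ ^ 2 : ℝ) : ℂ) := by
    intro i
    rw [← inner_conj_symm x (b i)]
    have := Complex.conj_mul' (inner ℂ (b i) x)
    push_cast
    rw [← this]; ring
  simp_rw [h3] at h1
  exact_mod_cast h1.symm

/-- With this lemma and the next, the two halves of the Courant–Fischer principle: the first `k`
terms of the expansion drop out here, those after index `k` drop out there. -/
theorem norm_apply_le_of_inner_eq_zero (T : E →ₗ[ℂ] F) {n : ℕ} (hn : Module.finrank ℂ E = n)
    (k : ℕ) (x : E) (hx : ∀ i : Fin n, (i : ℕ) < k →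
      inner ℂ (T.isSymmetric_adjoint_comp_self.eigenvectorBasis hn i) x = 0) :
    ‖T x‖ ≤ T.singularValues k * ‖x‖ := by
  refine le_of_sq_le_sq ?_ (mul_nonneg (T.singularValues_nonneg k) (norm_nonneg _))
  rw [norm_sq_apply_eq_sum T hn, mul_pow,
    ← (T.isSymmetric_adjoint_comp_self.eigenvectorBasis hn).sum_sq_norm_inner_right x,
    Finset.mul_sum]
  refine Finset.sum_le_sum fun i _ => ?_
  rcases lt_or_ge (i : ℕ) k with h | h
  · simp [hx i h]
  · have := T.singularValues_antitone h
    have h0 := T.singularValues_nonneg i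
    gcongr

theorem le_norm_apply_of_inner_eq_zero (T : E →ₗ[ℂ] F) {n : ℕ} (hn : Module.finrank ℂ E = n)
    (k : ℕ) (x : E) (hx : ∀ i : Fin n, k < (i : ℕ) →
      inner ℂ (T.isSymmetric_adjoint_comp_self.eigenvectorBasis hn i) x = 0) :
    T.singularValues k * ‖x‖ ≤ ‖T x‖ := by
  refine le_of_sq_le_sq ?_ (norm_nonneg _)
  rw [norm_sq_apply_eq_sum T hn, mul_pow,
    ← (T.isSymmetric_adjoint_comp_self.eigenvectorBasis hn).sum_sq_norm_inner_right x,
    Finset.mul_sum]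
  refine Finset.sum_le_sum fun i _ => ?_
  rcases lt_or_ge k (i : ℕ) with h | h
  · simp [hx i h]
  · have := T.singularValues_antitone h
    have h0 := T.singularValues_nonneg k
    gcongr

/-- Weyl's perturbation inequality for singular values. -/
theorem singularValues_le_add (S T : E →ₗ[ℂ] F) {c : ℝ} (hc : 0 ≤ c)
    (h : ∀ x, ‖S x‖ ≤ ‖T x‖ + c * ‖x‖) (k : ℕ) :
    S.singularValues k ≤ T.singularValues k + c := by
  rcases le_or_gt (Module.finrank ℂ E) k with hk | hk
  · rw [S.singularValues_of_finrank_le hk]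
    exact add_nonneg (T.singularValues_nonneg k) hc
  set n := Module.finrank ℂ E with hn
  set bS := S.isSymmetric_adjoint_comp_self.eigenvectorBasis hn.symm
  set bT := T.isSymmetric_adjoint_comp_self.eigenvectorBasis hn.symm
  let v : Fin (k + 1) → Fin n := fun i => ⟨i, lt_of_lt_of_le i.2 hk⟩
  let u : Fin k → Fin n := fun i => ⟨i, lt_trans i.2 hk⟩
  let Φ : (Fin (k + 1) → ℂ) →ₗ[ℂ] E := Fintype.linearCombination ℂ (fun i => bS (v i))
  let Ψ : (Fin (k + 1) → ℂ) →ₗ[ℂ] (Fin k → ℂ) :=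
    (LinearMap.pi fun j => (innerₛₗ ℂ (bT (u j)))) ∘ₗ Φ
  -- Dimension count: the span of the first `k + 1` right singular vectors of `S` contains a nonzero
  -- vector orthogonal to the first `k` of `T`. On it `S` is large and `T` is small.
  obtain ⟨c', hc', hne⟩ := (Submodule.ne_bot_iff _).1
    (LinearMap.ker_ne_bot_of_finrank_lt (f := Ψ) (by simp))
  have hvinj : Function.Injective v := fun i j hij => by
    simpa [v, Fin.ext_iff] using hij
  have hli : LinearIndependent ℂ (fun i => bS (v i)) :=
    (bS.orthonormal.comp v hvinj).linearIndependent
  have hx0 : Φ c' ≠ 0 := by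
    intro h0
    apply hne
    have := Fintype.linearIndependent_iff.1 hli c' (by simpa [Φ, Fintype.linearCombination_apply] using h0)
    ext i; exact this i
  have hS := le_norm_apply_of_inner_eq_zero S hn.symm k (Φ c') (fun i hi => by
    simp only [Φ, Fintype.linearCombination_apply, inner_sum, inner_smul_right]
    refine Finset.sum_eq_zero fun j _ => ?_
    rw [bS.inner_eq_zero, mul_zero]
    intro hij
    have : (i : ℕ) = j := by rw [hij]
    omega)
  have hT := norm_apply_le_of_inner_eq_zero T hn.symm k (Φ c') (fun i hi => by
    have := congrFun (LinearMap.mem_ker.1 hc') ⟨i, hi⟩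
    simpa [Ψ, u] using this)
  have hpos : 0 < ‖Φ c'‖ := norm_pos_iff.2 hx0
  refine le_of_mul_le_mul_right ?_ hpos
  rw [add_mul]
  exact hS.trans ((h _).trans (by gcongr))

theorem abs_singularValues_sub_le (S T : E →L[ℂ] F) (k : ℕ) :
    |(S : E →ₗ[ℂ] F).singularValues k - (T : E →ₗ[ℂ] F).singularValues k| ≤ ‖S - T‖ := by
  rw [abs_sub_le_iff]
  constructor
  · have := singularValues_le_add (S : E →ₗ[ℂ] F) T (norm_nonneg (S - T)) (fun x => by
      have h1 : S x = T x + (S - T) x := by simp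
      simp only [ContinuousLinearMap.coe_coe]
      rw [h1]
      exact (norm_add_le _ _).trans (by gcongr; exact (S - T).le_opNorm x)) k
    linarith
  · have := singularValues_le_add (T : E →ₗ[ℂ] F) S (norm_nonneg (S - T)) (fun x => by
      have h1 : T x = S x - (S - T) x := by simp
      simp only [ContinuousLinearMap.coe_coe]
      rw [h1]
      exact (norm_sub_le _ _).trans (by gcongr; exact (S - T).le_opNorm x)) k
    linarith

end SingularValues

/-! ### Singular values of matrices: continuity, extremal vectors, characteristic equation. -/

section SVal

variable {p m : ℕ}

theorem continuous_singularValues (k : ℕ) :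
    Continuous (fun T : EuclideanSpace ℂ (Fin m) →L[ℂ] EuclideanSpace ℂ (Fin p) =>
      (T : EuclideanSpace ℂ (Fin m) →ₗ[ℂ] EuclideanSpace ℂ (Fin p)).singularValues k) := by
  refine (LipschitzWith.of_dist_le_mul (K := 1) fun S T => ?_).continuous
  rw [Real.dist_eq, dist_eq_norm, NNReal.coe_one, one_mul]
  exact abs_singularValues_sub_le S T k

theorem continuous_toEuclideanCLM :
    Continuous (fun M : Matrix (Fin p) (Fin m) ℂ =>
      LinearMap.toContinuousLinearMap (Matrix.toEuclideanLin M)) :=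
  LinearMap.continuous_of_finiteDimensional
    (LinearMap.toContinuousLinearMap.toLinearMap ∘ₗ Matrix.toEuclideanLin.toLinearMap :
      Matrix (Fin p) (Fin m) ℂ →ₗ[ℂ] _)

theorem continuous_sval (k : ℕ) : Continuous (fun M : Matrix (Fin p) (Fin m) ℂ => sval M k) := by
  have h := (continuous_singularValues k).comp (continuous_toEuclideanCLM (p := p) (m := m))
  have e : (fun M : Matrix (Fin p) (Fin m) ℂ => sval M k) =
      (fun T : EuclideanSpace ℂ (Fin m) →L[ℂ] EuclideanSpace ℂ (Fin p) =>
        (T : EuclideanSpace ℂ (Fin m) →ₗ[ℂ] EuclideanSpace ℂ (Fin p)).singularValues k) ∘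
      (fun M : Matrix (Fin p) (Fin m) ℂ =>
        LinearMap.toContinuousLinearMap (Matrix.toEuclideanLin M)) := by
    funext M
    rw [Function.comp_apply, LinearMap.coe_toContinuousLinearMap, sval]
  rw [e]
  exact h

theorem continuous_svalMax : Continuous (svalMax : Matrix (Fin p) (Fin m) ℂ → ℝ) :=
  continuous_sval 0

theorem continuous_svalSecond : Continuous (svalSecond : Matrix (Fin p) (Fin m) ℂ → ℝ) :=
  continuous_sval 1

theorem sval_nonneg (M : Matrix (Fin p) (Fin m) ℂ) (k : ℕ) : 0 ≤ sval M k :=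
  LinearMap.singularValues_nonneg _ _

theorem norm_toEuclideanLin_le (M : Matrix (Fin p) (Fin m) ℂ) (x : EuclideanSpace ℂ (Fin m)) :
    ‖Matrix.toEuclideanLin M x‖ ≤ svalMax M * ‖x‖ :=
  norm_apply_le_of_inner_eq_zero _ rfl 0 x (by simp)

theorem svalMin_mul_norm_le {r : ℕ} (M : Matrix (Fin r) (Fin r) ℂ) (x : EuclideanSpace ℂ (Fin r)) :
    svalMin M * ‖x‖ ≤ ‖Matrix.toEuclideanLin M x‖ :=
  -- `r - 1` is the last index, so the orthogonality condition is vacuous, also for `r = 0`.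
  le_norm_apply_of_inner_eq_zero _ (n := r) (by simp) (r - 1) x (by intro i hi; omega)

theorem exists_svalMax_eq (M : Matrix (Fin p) (Fin m) ℂ) (h : 0 < svalMax M) :
    ∃ x : EuclideanSpace ℂ (Fin m), ‖x‖ = 1 ∧ ‖Matrix.toEuclideanLin M x‖ = svalMax M ∧
      LinearMap.adjoint (Matrix.toEuclideanLin M) (Matrix.toEuclideanLin M x) =
        ((svalMax M ^ 2 : ℝ) : ℂ) • x := by
  set T := Matrix.toEuclideanLin M
  have hm : 0 < m := by
    rcases Nat.eq_zero_or_pos m with rfl | hm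
    · have : T.singularValues 0 = 0 := T.singularValues_of_finrank_le (by simp)
      exact absurd this h.ne'
    · exact hm
  have hn : Module.finrank ℂ (EuclideanSpace ℂ (Fin m)) = m := by simp
  set b := T.isSymmetric_adjoint_comp_self.eigenvectorBasis hn
  have hx : ‖b ⟨0, hm⟩‖ = 1 := b.orthonormal.1 _
  refine ⟨b ⟨0, hm⟩, hx, le_antisymm ?_ ?_, ?_⟩
  · simpa [hx] using norm_toEuclideanLin_le M (b ⟨0, hm⟩)
  · have := le_norm_apply_of_inner_eq_zero T hn 0 (b ⟨0, hm⟩) (fun i hi => by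
      rw [b.inner_eq_zero]
      intro h0
      rw [h0] at hi
      simp at hi)
    rw [hx, mul_one] at this
    exact this
  · have := T.isSymmetric_adjoint_comp_self.apply_eigenvectorBasis hn ⟨0, hm⟩
    rw [← T.sq_singularValues_fin hn] at this
    exact this

theorem svalMax_le_of_forall (M : Matrix (Fin p) (Fin m) ℂ) {c : ℝ} (hc : 0 ≤ c)
    (h : ∀ x, ‖Matrix.toEuclideanLin M x‖ ≤ c * ‖x‖) : svalMax M ≤ c := by
  rcases (sval_nonneg M 0).eq_or_lt with h0 | h0
  · exact h0.symm.trans_le hc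
  · obtain ⟨x, hx, hMx, -⟩ := exists_svalMax_eq M h0
    have := h x
    rwa [hx, mul_one, hMx] at this

/-- The singular values solve the characteristic equation of `Mᴴ M`. -/
theorem det_smul_one_sub_eq_prod (M : Matrix (Fin p) (Fin m) ℂ) (t : ℝ) :
    ((t : ℂ) • (1 : Matrix (Fin m) (Fin m) ℂ) - Mᴴ * M).det =
      ((∏ i : Fin m, (t - sval M i ^ 2) : ℝ) : ℂ) := by
  set T := Matrix.toEuclideanLin M with hT
  have hn : Module.finrank ℂ (EuclideanSpace ℂ (Fin m)) = m := by simp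
  have h1 := T.isSymmetric_adjoint_comp_self.charpoly_eq hn
  have h2 : LinearMap.adjoint T ∘ₗ T = Matrix.toEuclideanLin (Mᴴ * M) := by
    rw [hT, ← Matrix.toEuclideanLin_conjTranspose_eq_adjoint]
    ext x : 1
    simp [Matrix.toEuclideanLin]
  have h3 : (LinearMap.adjoint T ∘ₗ T).charpoly = (Mᴴ * M).charpoly := by
    rw [h2, Matrix.toEuclideanLin_eq_toLin_orthonormal, Matrix.charpoly_toLin]
  rw [h3] at h1
  have h4 := congrArg (Polynomial.eval (t : ℂ)) h1
  rw [Matrix.eval_charpoly, Polynomial.eval_prod, Matrix.scalar_apply,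
    ← Matrix.smul_one_eq_diagonal] at h4
  rw [h4]
  push_cast
  refine Finset.prod_congr rfl fun i _ => ?_
  rw [← T.sq_singularValues_fin hn i]
  simp [sval, hT]

/-! ### Smoothness of matrix operations and of a simple largest singular value. -/

section Smooth

attribute [local instance] Matrix.normedAddCommGroup Matrix.normedSpace

theorem contDiffAt_matrix {X : Type*} [NormedAddCommGroup X] [NormedSpace ℝ X] {a b : ℕ}
    {n : WithTop ℕ∞} {f : X → Matrix (Fin a) (Fin b) ℂ} {x : X} :
    ContDiffAt ℝ n f x ↔ ∀ i j, ContDiffAt ℝ n (fun y => f y i j) x := by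
  have h1 := contDiffAt_pi (𝕜 := ℝ) (n := n) (x := x) (Φ := fun y => (f y : Fin a → Fin b → ℂ))
  refine h1.trans (forall_congr' fun i => ?_)
  exact contDiffAt_pi (𝕜 := ℝ) (n := n) (x := x) (Φ := fun y => (f y i : Fin b → ℂ))

variable {X : Type*} [NormedAddCommGroup X] [NormedSpace ℝ X] {n : WithTop ℕ∞} {x : X} {a b c : ℕ}

theorem ContDiffAt.matrix_mul {f : X → Matrix (Fin a) (Fin b) ℂ} {g : X → Matrix (Fin b) (Fin c) ℂ}
    (hf : ContDiffAt ℝ n f x) (hg : ContDiffAt ℝ n g x) :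
    ContDiffAt ℝ n (fun y => f y * g y) x := by
  rw [contDiffAt_matrix] at *
  intro i j
  simp only [Matrix.mul_apply]
  exact ContDiffAt.sum fun k _ => (hf i k).mul (hg k j)

theorem ContDiffAt.matrix_conjTranspose {f : X → Matrix (Fin a) (Fin b) ℂ}
    (hf : ContDiffAt ℝ n f x) : ContDiffAt ℝ n (fun y => (f y)ᴴ) x := by
  rw [contDiffAt_matrix] at *
  intro i j
  simp only [Matrix.conjTranspose_apply]
  exact Complex.conjCLE.contDiff.contDiffAt.comp x (hf j i)

theorem ContDiffAt.matrix_det {f : X → Matrix (Fin a) (Fin a) ℂ}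
    (hf : ContDiffAt ℝ n f x) : ContDiffAt ℝ n (fun y => (f y).det) x := by
  rw [contDiffAt_matrix] at hf
  simp only [Matrix.det_apply]
  refine ContDiffAt.sum fun σ _ => ?_
  exact (contDiffAt_prod fun i _ => hf (σ i) i).const_smul _

theorem ContDiffAt.matrix_inv {f : X → Matrix (Fin a) (Fin a) ℂ}
    (hf : ContDiffAt ℝ n f x) (hx : (f x).det ≠ 0) : ContDiffAt ℝ n (fun y => (f y)⁻¹) x := by
  rw [contDiffAt_matrix]
  intro i j
  simp only [Matrix.inv_def, Ring.inverse_eq_inv', Matrix.smul_apply, smul_eq_mul,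
    Matrix.adjugate_apply]
  refine (hf.matrix_det.inv hx).mul (ContDiffAt.matrix_det ?_)
  rw [contDiffAt_matrix] at *
  intro k l
  by_cases hk : k = j
  · subst hk
    simp only [Matrix.updateRow_self]
    exact contDiffAt_const
  · simp only [Matrix.updateRow_ne hk]
    exact hf k l

/-- A continuous zero branch of an equation with invertible partial derivative is smooth. -/
theorem contDiffAt_of_eventually_zero [CompleteSpace X] {h : X × ℝ → ℝ} (hn : n ≠ 0) {w : X → ℝ}
    (hh : ContDiffAt ℝ n h (x, w x)) (hne : deriv (fun t => h (x, t)) (w x) ≠ 0)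
    (hw : ContinuousAt w x) (hzero : ∀ y, h (y, w y) = 0) : ContDiffAt ℝ n w x := by
  have hinv := isInvertible_fderiv_inr (hh.differentiableAt hn) hne
  have hψC := hh.contDiffAt_implicitFunction hn hinv
  have hev := hh.eventually_apply_eq_iff_implicitFunction hn hinv
  have hcont : Tendsto (fun y => (y, w y)) (𝓝 x) (𝓝 (x, w x)) :=
    (continuousAt_id.prodMk hw)
  refine hψC.congr_of_eventuallyEq ?_
  filter_upwards [hcont.eventually hev] with y hy
  exact (hy.1 (by rw [hzero, hzero])).symm

/-- The largest singular value is smooth where it is simple. -/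
theorem contDiffAt_svalMax {p m : ℕ} (hn : n ≠ 0) (M : Matrix (Fin p) (Fin m) ℂ)
    (h : svalSecond M < svalMax M) : ContDiffAt ℝ n svalMax M := by
  have hpos : 0 < svalMax M := lt_of_le_of_lt (sval_nonneg M 1) h
  obtain ⟨m, rfl⟩ : ∃ m', m = m' + 1 := by
    refine Nat.exists_eq_succ_of_ne_zero ?_
    rintro rfl
    exact hpos.ne' ((Matrix.toEuclideanLin M).singularValues_of_finrank_le (by simp))
  -- The characteristic polynomial of `NᴴN` at `t`, polynomial in `t` and in the real and imaginary
  -- parts of the entries. The squared largest singular value is a continuous branch of its roots,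
  -- so only simplicity of the root has to be checked.
  let g : Matrix (Fin p) (Fin (m + 1)) ℂ × ℝ → ℝ := fun z =>
    (((z.2 : ℂ) • (1 : Matrix (Fin (m + 1)) (Fin (m + 1)) ℂ) - z.1ᴴ * z.1).det).re
  have hg : ∀ N t, g (N, t) = ∏ i : Fin (m + 1), (t - sval N i ^ 2) := fun N t => by
    simp only [g, det_smul_one_sub_eq_prod, Complex.ofReal_re]
  have hgC : ContDiffAt ℝ n g (M, svalMax M ^ 2) := by
    refine Complex.reCLM.contDiff.contDiffAt.comp _ (ContDiffAt.matrix_det ?_)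
    refine ContDiffAt.sub ?_ ((ContDiffAt.matrix_conjTranspose contDiffAt_fst).matrix_mul
      contDiffAt_fst)
    refine ContDiffAt.smul (Complex.ofRealCLM.contDiff.contDiffAt.comp _ contDiffAt_snd)
      contDiffAt_const
  have hsq : ContDiffAt ℝ n (fun N : Matrix (Fin p) (Fin (m + 1)) ℂ => svalMax N ^ 2) M := by
    have : CompleteSpace (Matrix (Fin p) (Fin (m + 1)) ℂ) :=
      inferInstanceAs (CompleteSpace (Fin p → Fin (m + 1) → ℂ))
    refine contDiffAt_of_eventually_zero hn hgC ?_ (continuous_svalMax.pow 2).continuousAt ?_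
    -- At the top root the `t`-derivative is the product of the other factors, all positive by the
    -- gap.
    · simp only [hg, Fin.prod_univ_succ]
      have hP : DifferentiableAt ℝ
          (fun t : ℝ => ∏ i : Fin m, (t - sval M (Fin.succ i : Fin (m + 1)) ^ 2)) (svalMax M ^ 2) := by
        fun_prop
      have hd := (((hasDerivAt_id (svalMax M ^ 2)).sub_const (sval M 0 ^ 2))).mul hP.hasDerivAt
      have h0 : svalMax M ^ 2 - sval M 0 ^ 2 = 0 := sub_self _
      simp only [id, h0, zero_mul, add_zero, one_mul] at hd
      have := hd.deriv
      simp only [Fin.val_zero]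
      refine (Eq.trans_ne this ?_)
      refine Finset.prod_ne_zero_iff.2 fun i _ => ?_
      have h1 : sval M (Fin.succ i : Fin (m + 1)) ≤ sval M 1 :=
        (Matrix.toEuclideanLin M).singularValues_antitone (by simp)
      have h2 := sval_nonneg M (Fin.succ i : Fin (m + 1))
      have h3 : sval M (Fin.succ i : Fin (m + 1)) < svalMax M := lt_of_le_of_lt h1 h
      have : sval M (Fin.succ i : Fin (m + 1)) ^ 2 < svalMax M ^ 2 := by gcongr
      linarith
    · intro N
      rw [hg, Fin.prod_univ_succ]
      simp [svalMax]
  have := hsq.sqrt (pow_pos hpos 2).ne'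
  refine this.congr_of_eventuallyEq (Eventually.of_forall fun N => ?_)
  exact (Real.sqrt_sq (sval_nonneg N 0)).symm

end Smooth

end SVal

/-! ### Evaluation of transfer functions -/

section Transfer

open Polynomial

/-- The denominator in lowest terms divides `b`, so it cannot vanish where `b` does not. -/
theorem eval_algebraMap_div {a b : ℂ[X]} {s : ℂ} (hb : b.eval s ≠ 0) :
    RatFunc.eval (RingHom.id ℂ) s (algebraMap ℂ[X] (RatFunc ℂ) a / algebraMap ℂ[X] (RatFunc ℂ) b) =
      a.eval s / b.eval s := by
  have hb0 : b ≠ 0 := by rintro rfl; simp at hb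
  set f := algebraMap ℂ[X] (RatFunc ℂ) a / algebraMap ℂ[X] (RatFunc ℂ) b with hf
  have hdvd : f.denom ∣ b := RatFunc.denom_div_dvd a b
  have hden : f.denom.eval s ≠ 0 := by
    obtain ⟨c, hc⟩ := hdvd
    intro h0
    rw [hc, eval_mul, h0, zero_mul] at hb
    exact hb rfl
  have h1 : f.num * b = a * f.denom := by
    have := RatFunc.num_div_denom f
    conv_rhs at this => rw [hf]
    rw [div_eq_div_iff (by simpa using f.denom_ne_zero) (by simpa using hb0), ← map_mul,
      ← map_mul] at this
    exact IsFractionRing.injective ℂ[X] (RatFunc ℂ) this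
  have h2 := congrArg (Polynomial.eval s) h1
  rw [eval_mul, eval_mul] at h2
  rw [RatFunc.eval, eval₂_id, eval₂_id, div_eq_div_iff hden hb, h2]

/-- Where the pencil is invertible, the transfer function takes the expected value. -/
theorem evalAt_transfer {r m p : ℕ} (E A : Matrix (Fin r) (Fin r) ℂ) (B : Matrix (Fin r) (Fin m) ℂ)
    (C : Matrix (Fin p) (Fin r) ℂ) {s : ℂ} (hs : (s • E - A).det ≠ 0) :
    evalAt (transfer E A B C) s = C * (s • E - A)⁻¹ * B := by
  -- Cramer's rule over the polynomials: the transfer function is `N / det P`, and evaluation at `s`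
  -- commutes with adjugate and determinant.
  let P : Matrix (Fin r) (Fin r) ℂ[X] := (X : ℂ[X]) • E.map Polynomial.C - A.map Polynomial.C
  let N : Matrix (Fin p) (Fin m) ℂ[X] := C.map Polynomial.C * P.adjugate * B.map Polynomial.C
  let ι := algebraMap ℂ[X] (RatFunc ℂ)
  have hPι : (RatFunc.X : RatFunc ℂ) • E.map RatFunc.C - A.map RatFunc.C = P.map ι := by
    ext i j
    simp [P, ι]
    ring
  have hPs : P.map (evalRingHom s) = s • E - A := by
    ext i j
    simp [P]
    ring
  have hdet : P.det.eval s = (s • E - A).det := by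
    rw [← hPs, ← coe_evalRingHom, RingHom.map_det, RingHom.mapMatrix_apply]
  have hT : ∀ i j, transfer E A B C i j = ι (N i j) / ι P.det := by
    intro i j
    have h1 : transfer E A B C = (ι P.det)⁻¹ • N.map ι := by
      have hC : C.map RatFunc.C = (C.map Polynomial.C).map ι := by ext; simp [ι]
      have hB : B.map RatFunc.C = (B.map Polynomial.C).map ι := by ext; simp [ι]
      have hadj : (P.map ι).adjugate = P.adjugate.map ι := by
        have := RingHom.map_adjugate ι P
        simpa [RingHom.mapMatrix_apply] using this.symm
      have hdet' : (P.map ι).det = ι P.det := by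
        rw [RingHom.map_det, RingHom.mapMatrix_apply]
      rw [transfer, hPι, Matrix.inv_def, Ring.inverse_eq_inv', hC, hB, hadj, hdet',
        Matrix.mul_smul, Matrix.smul_mul, ← Matrix.map_mul, ← Matrix.map_mul]
    rw [h1]
    simp [div_eq_inv_mul]
  ext i j
  rw [evalAt, Matrix.map_apply, hT, eval_algebraMap_div (by rwa [hdet]), hdet, Matrix.inv_def,
    Ring.inverse_eq_inv', Matrix.mul_smul, Matrix.smul_mul, Matrix.smul_apply, smul_eq_mul,
    div_eq_inv_mul]
  congr 1
  have hadj : (s • E - A).adjugate = P.adjugate.map (evalRingHom s) := by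
    have := RingHom.map_adjugate (evalRingHom s) P
    rw [RingHom.mapMatrix_apply, RingHom.mapMatrix_apply, hPs] at this
    exact this.symm
  have hC : C = (C.map Polynomial.C).map (evalRingHom s) := by ext; simp
  have hB : B = (B.map Polynomial.C).map (evalRingHom s) := by ext; simp
  rw [hadj]
  conv_rhs => rw [hC, hB, ← Matrix.map_mul, ← Matrix.map_mul]
  simp [N]

end Transfer

namespace ParamSystem

variable {d n m p : ℕ} (S : ParamSystem d n m p)

/-! ### Reduced systems as compressions of the full one. -/

section Reduced

variable {r : ℕ} (V W : Matrix (Fin n) (Fin r) ℂ)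

theorem cplx_sum_smul {a b κ : ℕ} (c : Fin κ → ℝ) (M : Fin κ → Matrix (Fin a) (Fin b) ℝ) :
    cplx (∑ i, c i • M i) = ∑ i, (c i : ℂ) • cplx (M i) := by
  ext i j
  simp [cplx, Matrix.sum_apply]

theorem redE_eq (μ : EuclideanSpace ℝ (Fin d)) : S.redE V W μ = Wᴴ * cplx (S.E μ) * V := by
  simp [redE, E, cplx_sum_smul, Matrix.mul_sum, Matrix.sum_mul]

theorem redA_eq (μ : EuclideanSpace ℝ (Fin d)) : S.redA V W μ = Wᴴ * cplx (S.A μ) * V := by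
  simp [redA, A, cplx_sum_smul, Matrix.mul_sum, Matrix.sum_mul]

theorem redB_eq (μ : EuclideanSpace ℝ (Fin d)) : S.redB W μ = Wᴴ * cplx (S.B μ) := by
  simp [redB, B, cplx_sum_smul, Matrix.mul_sum]

theorem redC_eq (μ : EuclideanSpace ℝ (Fin d)) : S.redC V μ = cplx (S.C μ) * V := by
  simp [redC, C, cplx_sum_smul, Matrix.sum_mul]

theorem redD_eq (μ : EuclideanSpace ℝ (Fin d)) (s : ℂ) :
    S.redD V W μ s = Wᴴ * S.D μ s * V := by
  simp [redD, D, redE_eq, redA_eq, Matrix.mul_sub, Matrix.sub_mul]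

/-- With `V = W = 1` the full system is one of the reduced systems, so every uniform statement about
these covers it. -/
theorem redD_one (μ : EuclideanSpace ℝ (Fin d)) (s : ℂ) : S.redD (1 : Matrix (Fin n) (Fin n) ℂ) 1 μ s = S.D μ s := by
  simp [redD_eq]

theorem redH_one (μ : EuclideanSpace ℝ (Fin d)) (s : ℂ) : S.redH (1 : Matrix (Fin n) (Fin n) ℂ) 1 μ s = S.H μ s := by
  simp [redH, H, redE_eq, redA_eq, redB_eq, redC_eq]

theorem redSigma_one : S.redSigma (1 : Matrix (Fin n) (Fin n) ℂ) 1 = S.sigma := by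
  funext μ ω; simp [redSigma, sigma, redH_one]

theorem redSigmaSecond_one : S.redSigmaSecond (1 : Matrix (Fin n) (Fin n) ℂ) 1 = S.sigmaSecond := by
  funext μ ω; simp [redSigmaSecond, sigmaSecond, redH_one]

variable {V W} in
theorem redH_of_det_ne_zero {μ : EuclideanSpace ℝ (Fin d)} {s : ℂ}
    (h : (S.redD V W μ s).det ≠ 0) :
    S.redH V W μ s = S.redC V μ * (S.redD V W μ s)⁻¹ * S.redB W μ :=
  evalAt_transfer _ _ _ _ h

theorem H_of_det_ne_zero {μ : EuclideanSpace ℝ (Fin d)} {s : ℂ} (h : (S.D μ s).det ≠ 0) :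
    S.H μ s = cplx (S.C μ) * (S.D μ s)⁻¹ * cplx (S.B μ) :=
  evalAt_transfer _ _ _ _ h

end Reduced

/-! ### Joint regularity of the singular values of reduced systems -/

section Regularity

attribute [local instance] Matrix.normedAddCommGroup Matrix.normedSpace

variable {r : ℕ}

theorem contDiffAt_sum_smul {X : Type*} [NormedAddCommGroup X] [NormedSpace ℝ X] {a b κ : ℕ}
    {N : WithTop ℕ∞} {x : X} {c : Fin κ → EuclideanSpace ℝ (Fin d) → ℝ}
    {μ : X → EuclideanSpace ℝ (Fin d)} (hc : ∀ i, AnalyticAt ℝ (c i) (μ x))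
    (hμ : ContDiffAt ℝ N μ x) {M : Fin κ → X → Matrix (Fin a) (Fin b) ℂ}
    (hM : ∀ i, ContDiffAt ℝ N (M i) x) :
    ContDiffAt ℝ N (fun y => ∑ i, (c i (μ y) : ℂ) • M i y) x := by
  refine ContDiffAt.sum fun i _ => ?_
  refine ContDiffAt.smul (f := fun y => (c i (μ y) : ℂ)) ?_ (hM i)
  exact Complex.ofRealCLM.contDiff.contDiffAt.comp x ((hc i).contDiffAt.comp x hμ)

/-- The projection matrices are variables like the parameter and the frequency, so that compactness
in them yields uniform constants. The nesting is that of `exists_uniform_branch`. -/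
abbrev ReducedPoint (d n r : ℕ) : Type :=
  ((Matrix (Fin n) (Fin r) ℂ × Matrix (Fin n) (Fin r) ℂ) × EuclideanSpace ℝ (Fin d)) × ℝ

theorem contDiffAt_redD (z : ReducedPoint d n r) (hz : z.1.2 ∈ S.Ω) (N : WithTop ℕ∞) :
    ContDiffAt ℝ N (fun y : ReducedPoint d n r =>
      S.redD y.1.1.1 y.1.1.2 y.1.2 (Complex.I * y.2)) z := by
  have hV : ContDiffAt ℝ N (fun y : ReducedPoint d n r => y.1.1.1) z := by fun_prop
  have hW : ContDiffAt ℝ N (fun y : ReducedPoint d n r => y.1.1.2) z := by fun_prop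
  have hμ : ContDiffAt ℝ N (fun y : ReducedPoint d n r => y.1.2) z := by fun_prop
  have hω : ContDiffAt ℝ N (fun y : ReducedPoint d n r => Complex.I * (y.2 : ℂ)) z :=
    contDiffAt_const.mul (Complex.ofRealCLM.contDiff.contDiffAt.comp z contDiffAt_snd)
  refine ContDiffAt.sub (hω.smul ?_) ?_
  · exact contDiffAt_sum_smul (X := ReducedPoint d n r) (μ := fun y => y.1.2) (x := z)
      (fun i => S.analytic_f i _ hz) hμ fun i =>
      (hW.matrix_conjTranspose.matrix_mul contDiffAt_const).matrix_mul hV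
  · exact contDiffAt_sum_smul (X := ReducedPoint d n r) (μ := fun y => y.1.2) (x := z)
      (fun i => S.analytic_g i _ hz) hμ fun i =>
      (hW.matrix_conjTranspose.matrix_mul contDiffAt_const).matrix_mul hV

theorem eventually_det_redD_ne_zero (z : ReducedPoint d n r) (hz : z.1.2 ∈ S.Ω)
    (hdet : (S.redD z.1.1.1 z.1.1.2 z.1.2 (Complex.I * z.2)).det ≠ 0) :
    ∀ᶠ y : ReducedPoint d n r in 𝓝 z,
      (S.redD y.1.1.1 y.1.1.2 y.1.2 (Complex.I * y.2)).det ≠ 0 :=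
  (S.contDiffAt_redD z hz 0).matrix_det.continuousAt.eventually_ne hdet

theorem contDiffAt_redH (z : ReducedPoint d n r) (hz : z.1.2 ∈ S.Ω)
    (hdet : (S.redD z.1.1.1 z.1.1.2 z.1.2 (Complex.I * z.2)).det ≠ 0) (N : WithTop ℕ∞) :
    ContDiffAt ℝ N (fun y : ReducedPoint d n r =>
      S.redH y.1.1.1 y.1.1.2 y.1.2 (Complex.I * y.2)) z := by
  have hV : ContDiffAt ℝ N (fun y : ReducedPoint d n r => y.1.1.1) z := by fun_prop
  have hW : ContDiffAt ℝ N (fun y : ReducedPoint d n r => y.1.1.2) z := by fun_prop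
  have hμ : ContDiffAt ℝ N (fun y : ReducedPoint d n r => y.1.2) z := by fun_prop
  have hB : ContDiffAt ℝ N (fun y : ReducedPoint d n r => S.redB y.1.1.2 y.1.2) z :=
    contDiffAt_sum_smul (X := ReducedPoint d n r) (μ := fun y => y.1.2) (x := z)
      (fun i => S.analytic_h i _ hz) hμ fun i =>
      hW.matrix_conjTranspose.matrix_mul contDiffAt_const
  have hC : ContDiffAt ℝ N (fun y : ReducedPoint d n r => S.redC y.1.1.1 y.1.2) z :=
    contDiffAt_sum_smul (X := ReducedPoint d n r) (μ := fun y => y.1.2) (x := z)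
      (fun i => S.analytic_k i _ hz) hμ fun i =>
      contDiffAt_const.matrix_mul hV
  refine ((hC.matrix_mul ((S.contDiffAt_redD z hz N).matrix_inv hdet)).matrix_mul
    hB).congr_of_eventuallyEq ?_
  filter_upwards [S.eventually_det_redD_ne_zero z hz hdet] with y hy
  exact S.redH_of_det_ne_zero hy

theorem contDiffAt_redSigma (z : ReducedPoint d n r) (hz : z.1.2 ∈ S.Ω)
    (hdet : (S.redD z.1.1.1 z.1.1.2 z.1.2 (Complex.I * z.2)).det ≠ 0)
    (hgap : S.redSigmaSecond z.1.1.1 z.1.1.2 z.1.2 z.2 < S.redSigma z.1.1.1 z.1.1.2 z.1.2 z.2)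
    {N : WithTop ℕ∞} (hN : N ≠ 0) :
    ContDiffAt ℝ N (fun y : ReducedPoint d n r => S.redSigma y.1.1.1 y.1.1.2 y.1.2 y.2) z :=
  ContDiffAt.comp (g := svalMax) z (contDiffAt_svalMax hN _ hgap) (S.contDiffAt_redH z hz hdet N)

theorem differentiableAt_redSigma {V W : Matrix (Fin n) (Fin r) ℂ}
    {μ : EuclideanSpace ℝ (Fin d)} {ω : ℝ} (hμ : μ ∈ S.Ω)
    (hdet : (S.redD V W μ (Complex.I * ω)).det ≠ 0)
    (hgap : 0 < S.redSigma V W μ ω - S.redSigmaSecond V W μ ω) :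
    DifferentiableAt ℝ (S.redSigma V W μ) ω :=
  (hasDerivAt_snd ((S.contDiffAt_redSigma (((V, W), μ), ω) hμ hdet (sub_pos.1 hgap)
    one_ne_zero).differentiableAt one_ne_zero)).differentiableAt

/-- The gap between the two largest singular values of a reduced transfer function. -/
noncomputable def redGap (q : Matrix (Fin n) (Fin r) ℂ × Matrix (Fin n) (Fin r) ℂ)
    (μ : EuclideanSpace ℝ (Fin d)) (ω : ℝ) : ℝ :=
  S.redSigma q.1 q.2 μ ω - S.redSigmaSecond q.1 q.2 μ ω

/-- Singular values are continuous even where they are multiple, so an invertible pencil suffices.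
This permits estimates of the gap before it is known to be positive. -/
theorem continuousAt_redGap (z : ReducedPoint d n r) (hz : z.1.2 ∈ S.Ω)
    (hdet : (S.redD z.1.1.1 z.1.1.2 z.1.2 (Complex.I * z.2)).det ≠ 0) :
    ContinuousAt (fun y : ReducedPoint d n r => S.redGap y.1.1 y.1.2 y.2) z := by
  have h := (S.contDiffAt_redH z hz hdet 0).continuousAt
  exact (continuous_svalMax.continuousAt.comp (f := fun y : ReducedPoint d n r =>
      S.redH y.1.1.1 y.1.1.2 y.1.2 (Complex.I * y.2)) h).sub
    (continuous_svalSecond.continuousAt.comp (f := fun y : ReducedPoint d n r =>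
      S.redH y.1.1.1 y.1.1.2 y.1.2 (Complex.I * y.2)) h)

end Regularity

end ParamSystem

/-! ### Singular vectors -/

section SingularVectors

variable {p m : ℕ}

/-- A unit pair of singular vectors for the largest singular value. -/
theorem exists_singular_pair (M : Matrix (Fin p) (Fin m) ℂ) (h : 0 < svalMax M) :
    ∃ (u : Fin p → ℂ) (v : Fin m → ℂ), ‖WithLp.toLp 2 u‖ = 1 ∧ ‖WithLp.toLp 2 v‖ = 1 ∧
      M *ᵥ v = (svalMax M : ℂ) • u ∧ Mᴴ *ᵥ u = (svalMax M : ℂ) • v := by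
  obtain ⟨x, hx, hMx, hadj⟩ := exists_svalMax_eq M h
  have hσ : (svalMax M : ℂ) ≠ 0 := by exact_mod_cast h.ne'
  refine ⟨(svalMax M : ℂ)⁻¹ • (M *ᵥ x.ofLp), x.ofLp, ?_, hx, ?_, ?_⟩
  · have : WithLp.toLp 2 ((svalMax M : ℂ)⁻¹ • (M *ᵥ x.ofLp)) =
        (svalMax M : ℂ)⁻¹ • Matrix.toEuclideanLin M x := rfl
    rw [this, norm_smul, hMx, norm_inv, Complex.norm_real, Real.norm_of_nonneg h.le,
      inv_mul_cancel₀ h.ne']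
  · rw [smul_smul, mul_inv_cancel₀ hσ, one_smul]
  · rw [← Matrix.toEuclideanLin_conjTranspose_eq_adjoint] at hadj
    have h2 := congrArg WithLp.ofLp hadj
    simp only [Matrix.ofLp_toLpLin, Matrix.toLin'_apply, WithLp.ofLp_smul] at h2
    rw [Matrix.mulVec_smul, h2, smul_smul]
    congr 1
    push_cast
    field_simp

theorem norm_star_dotProduct_mulVec_le (M : Matrix (Fin p) (Fin m) ℂ) (u : Fin p → ℂ)
    (v : Fin m → ℂ) :
    ‖star u ⬝ᵥ (M *ᵥ v)‖ ≤ svalMax M * ‖WithLp.toLp 2 u‖ * ‖WithLp.toLp 2 v‖ := by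
  have h1 : star u ⬝ᵥ (M *ᵥ v) =
      inner ℂ (WithLp.toLp 2 u) (Matrix.toEuclideanLin M (WithLp.toLp 2 v)) := by
    rw [EuclideanSpace.inner_eq_star_dotProduct, dotProduct_comm]
    rfl
  rw [h1]
  refine (norm_inner_le_norm _ _).trans ?_
  have := norm_toEuclideanLin_le M (WithLp.toLp 2 v)
  calc _ ≤ ‖WithLp.toLp 2 u‖ * (svalMax M * ‖WithLp.toLp 2 v‖) := by gcongr
    _ = _ := by ring

theorem star_dotProduct_self (u : Fin p → ℂ) : star u ⬝ᵥ u = ((‖WithLp.toLp 2 u‖ ^ 2 : ℝ) : ℂ) := by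
  have := inner_self_eq_norm_sq_to_K (𝕜 := ℂ) (WithLp.toLp 2 u)
  rw [EuclideanSpace.inner_eq_star_dotProduct, dotProduct_comm] at this
  simpa using this

theorem norm_entry_le_svalMax (M : Matrix (Fin p) (Fin m) ℂ) (i : Fin p) (j : Fin m) :
    ‖M i j‖ ≤ svalMax M := by
  have := norm_star_dotProduct_mulVec_le M (Pi.single i 1) (Pi.single j 1)
  have e1 : ‖WithLp.toLp 2 (Pi.single i (1 : ℂ) : Fin p → ℂ)‖ = 1 := by
    simp
  have e2 : ‖WithLp.toLp 2 (Pi.single j (1 : ℂ) : Fin m → ℂ)‖ = 1 := by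
    simp
  rw [e1, e2, mul_one, mul_one] at this
  have h0 : star (Pi.single i (1 : ℂ) : Fin p → ℂ) ⬝ᵥ (M *ᵥ Pi.single j 1) = M i j := by
    rw [← Pi.single_star, star_one, Matrix.mulVec_single_one, single_one_dotProduct]
    rfl
  rwa [h0] at this

end SingularVectors

/-! ### Interpolation -/

section Interpolation

section

attribute [local instance] Matrix.normedAddCommGroup Matrix.normedSpace

/-- The derivative of the inverse is `-D⁻¹ N D⁻¹`; the solutions `x` and `y` absorb both inverses,
and in this form reduced and full systems can be compared. -/
theorem hasDerivAt_star_dotProduct_inv {r : ℕ} {D N : Matrix (Fin r) (Fin r) ℂ}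
    (hD : D.det ≠ 0) {a b x y : Fin r → ℂ} (hx : D *ᵥ x = b) (hy : Dᴴ *ᵥ y = a) (t₀ : ℝ) :
    HasDerivAt (fun t : ℝ => star a ⬝ᵥ ((D + ((t - t₀ : ℝ) : ℂ) • N)⁻¹ *ᵥ b))
      (-(star y ⬝ᵥ (N *ᵥ x))) t₀ := by
  let M : ℝ → Matrix (Fin r) (Fin r) ℂ := fun t => D + ((t - t₀ : ℝ) : ℂ) • N
  have hM0 : M t₀ = D := by simp [M]
  let g : ℝ → ℂ := fun t => star y ⬝ᵥ (N *ᵥ ((M t)⁻¹ *ᵥ b))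
  have hMC : ContDiffAt ℝ 1 M t₀ := by
    refine contDiffAt_const.add (ContDiffAt.smul (f := fun t : ℝ => ((t - t₀ : ℝ) : ℂ)) ?_
      contDiffAt_const)
    exact Complex.ofRealCLM.contDiff.contDiffAt.comp t₀ (contDiffAt_id.sub contDiffAt_const)
  have hev : ∀ᶠ t in 𝓝 t₀, (M t).det ≠ 0 :=
    hMC.matrix_det.continuousAt.eventually_ne (by rwa [hM0])
  have hinv := contDiffAt_matrix.1 (hMC.matrix_inv (by rwa [hM0]))
  have hg : DifferentiableAt ℝ g t₀ := by
    have e : g = fun t => ∑ k, (∑ i, star y i * N i k) * ∑ j, (M t)⁻¹ k j * b j := by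
      funext t
      simp only [g]
      rw [Matrix.dotProduct_mulVec]
      rfl
    rw [e]
    refine DifferentiableAt.fun_sum fun k _ => (differentiableAt_const _).mul ?_
    exact DifferentiableAt.fun_sum fun j _ =>
      ((hinv k j).differentiableAt one_ne_zero).mul (differentiableAt_const _)
  have hg0 : g t₀ = star y ⬝ᵥ (N *ᵥ x) := by
    simp only [g, hM0]
    rw [← hx, Matrix.mulVec_mulVec x, Matrix.nonsing_inv_mul _ (isUnit_iff_ne_zero.2 hD),
      Matrix.one_mulVec]
  have hlin : HasDerivAt (fun t : ℝ => ((t - t₀ : ℝ) : ℂ)) 1 t₀ := by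
    simpa using ((hasDerivAt_id t₀).sub_const t₀).ofReal_comp
  have hprod := (hlin.mul hg.hasDerivAt).const_sub (star y ⬝ᵥ b)
  simp only [sub_self, Complex.ofReal_zero, zero_mul, add_zero, one_mul, hg0] at hprod
  refine hprod.congr_of_eventuallyEq ?_
  -- Resolvent identity: the pairing equals `y*b` minus `t - t₀` times a differentiable function,
  -- whose value at `t₀` is all that enters the derivative.
  filter_upwards [hev] with t ht
  have h1 : M t *ᵥ ((M t)⁻¹ *ᵥ b) = b := by
    rw [Matrix.mulVec_mulVec, Matrix.mul_nonsing_inv _ (isUnit_iff_ne_zero.2 ht), Matrix.one_mulVec]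
  have h2 : D *ᵥ ((M t)⁻¹ *ᵥ b) = b - ((t - t₀ : ℝ) : ℂ) • (N *ᵥ ((M t)⁻¹ *ᵥ b)) := by
    rw [eq_sub_iff_add_eq, ← Matrix.smul_mulVec, ← Matrix.add_mulVec]
    exact h1
  change star a ⬝ᵥ ((M t)⁻¹ *ᵥ b) = star y ⬝ᵥ b - ((t - t₀ : ℝ) : ℂ) * g t
  rw [← hy, Matrix.star_mulVec, Matrix.conjTranspose_conjTranspose, ← Matrix.dotProduct_mulVec, h2,
    dotProduct_sub, dotProduct_smul, smul_eq_mul]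

end

theorem exists_mulVec_eq_of_col_le {a b c : ℕ} {M : Matrix (Fin a) (Fin b) ℂ}
    {V : Matrix (Fin a) (Fin c) ℂ} (h : col M ≤ col V) (z : Fin b → ℂ) :
    ∃ x, V *ᵥ x = M *ᵥ z := by
  obtain ⟨x, hx⟩ := h ⟨z, rfl⟩
  exact ⟨x, hx⟩

namespace ParamSystem

variable {d n m p : ℕ} (S : ParamSystem d n m p) {r : ℕ} {V W : Matrix (Fin n) (Fin r) ℂ}
  {μ : EuclideanSpace ℝ (Fin d)} {ω : ℝ}

/-- Galerkin projection is exact when the full solution lies in the trial space: its coordinates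
solve the reduced equation. The next lemma is the dual statement. -/
theorem redD_mulVec_eq (hD : (S.D μ (Complex.I * ω)).det ≠ 0) {x : Fin r → ℂ} {v : Fin m → ℂ}
    (hx : V *ᵥ x = ((S.D μ (Complex.I * ω))⁻¹ * cplx (S.B μ)) *ᵥ v) :
    S.redD V W μ (Complex.I * ω) *ᵥ x = S.redB W μ *ᵥ v := by
  rw [redD_eq, redB_eq, ← Matrix.mulVec_mulVec, hx, Matrix.mulVec_mulVec, Matrix.mul_assoc,
    Matrix.mul_nonsing_inv_cancel_left _ _ (isUnit_iff_ne_zero.2 hD)]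

theorem redD_conjTranspose_mulVec_eq (hD : (S.D μ (Complex.I * ω)).det ≠ 0) {y : Fin r → ℂ}
    {u : Fin p → ℂ}
    (hy : W *ᵥ y = (((S.D μ (Complex.I * ω))⁻¹)ᴴ * (cplx (S.C μ))ᴴ) *ᵥ u) :
    (S.redD V W μ (Complex.I * ω))ᴴ *ᵥ y = (S.redC V μ)ᴴ *ᵥ u := by
  have h1 : (S.redD V W μ (Complex.I * ω))ᴴ = Vᴴ * (S.D μ (Complex.I * ω))ᴴ * W := by
    simp [redD_eq, Matrix.conjTranspose_mul, Matrix.mul_assoc]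
  have h2 : (S.D μ (Complex.I * ω))ᴴ * (((S.D μ (Complex.I * ω))⁻¹)ᴴ * (cplx (S.C μ))ᴴ) =
      (cplx (S.C μ))ᴴ := by
    rw [← Matrix.mul_assoc, ← Matrix.conjTranspose_mul,
      Matrix.nonsing_inv_mul _ (isUnit_iff_ne_zero.2 hD), Matrix.conjTranspose_one, Matrix.one_mul]
  rw [h1, redC_eq, ← Matrix.mulVec_mulVec, hy, Matrix.mulVec_mulVec, Matrix.mul_assoc, h2,
    Matrix.conjTranspose_mul]

/-- The reduced transfer function interpolates the full one where the subspaces contain the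
directions of the algorithms. -/
theorem redH_eq_H (hD : (S.D μ (Complex.I * ω)).det ≠ 0)
    (hDr : (S.redD V W μ (Complex.I * ω)).det ≠ 0)
    (hV : S.newV μ ω ≤ col V) (hW : S.newW μ ω ≤ col W) :
    S.redH V W μ (Complex.I * ω) = S.H μ (Complex.I * ω) := by
  rw [S.redH_of_det_ne_zero hDr, S.H_of_det_ne_zero hD]
  -- Interpolation of the value needs only one side. If `m ≤ p`, the trial space contains the
  -- columns of all of `D⁻¹B`; otherwise the test space contains those of all of `D⁻*C*`.
  rcases le_or_gt m p with hmp | hmp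
  · rw [newV, if_pos hmp] at hV
    refine Matrix.ext_iff_mulVec.2 fun v => ?_
    obtain ⟨x, hx⟩ := exists_mulVec_eq_of_col_le hV v
    have h1 := S.redD_mulVec_eq (W := W) hD hx
    rw [← Matrix.mulVec_mulVec, ← h1, Matrix.mulVec_mulVec,
      Matrix.nonsing_inv_mul_cancel_right _ _ (isUnit_iff_ne_zero.2 hDr), redC_eq,
      ← Matrix.mulVec_mulVec, hx, Matrix.mulVec_mulVec, Matrix.mul_assoc]
  · rw [newW, if_pos hmp.le] at hW
    apply Matrix.conjTranspose_injective
    refine Matrix.ext_iff_mulVec.2 fun u => ?_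
    obtain ⟨y, hy⟩ := exists_mulVec_eq_of_col_le hW u
    have h1 := S.redD_conjTranspose_mulVec_eq (V := V) hD hy
    have h2 : ((S.redD V W μ (Complex.I * ω))⁻¹)ᴴ * (S.redD V W μ (Complex.I * ω))ᴴ = 1 := by
      rw [← Matrix.conjTranspose_mul, Matrix.mul_nonsing_inv _ (isUnit_iff_ne_zero.2 hDr),
        Matrix.conjTranspose_one]
    rw [Matrix.conjTranspose_mul, Matrix.conjTranspose_mul, ← Matrix.mulVec_mulVec,
      ← Matrix.mulVec_mulVec, ← h1, Matrix.mulVec_mulVec y, h2, Matrix.one_mulVec, redB_eq,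
      Matrix.conjTranspose_mul, Matrix.conjTranspose_conjTranspose, ← Matrix.mulVec_mulVec, hy,
      Matrix.conjTranspose_mul, Matrix.conjTranspose_mul, ← Matrix.mulVec_mulVec,
      ← Matrix.mulVec_mulVec, ← Matrix.mulVec_mulVec]

/-- The derivative involves `V, W` only through the lifted vectors `V x`, `W y`. When these are the
full solutions, reduced and full pairings have equal derivatives. -/
theorem hasDerivAt_pairing_redH (hDr : (S.redD V W μ (Complex.I * ω)).det ≠ 0)
    {u : Fin p → ℂ} {v : Fin m → ℂ} {x y : Fin r → ℂ}
    (hx : S.redD V W μ (Complex.I * ω) *ᵥ x = S.redB W μ *ᵥ v)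
    (hy : (S.redD V W μ (Complex.I * ω))ᴴ *ᵥ y = (S.redC V μ)ᴴ *ᵥ u) :
    HasDerivAt (fun t : ℝ => star u ⬝ᵥ (S.redH V W μ (Complex.I * t) *ᵥ v))
      (-(star (W *ᵥ y) ⬝ᵥ ((Complex.I • cplx (S.E μ)) *ᵥ (V *ᵥ x)))) ω := by
  have h := hasDerivAt_star_dotProduct_inv (N := Complex.I • S.redE V W μ) hDr hx hy ω
  have e : star y ⬝ᵥ ((Complex.I • S.redE V W μ) *ᵥ x) =
      star (W *ᵥ y) ⬝ᵥ ((Complex.I • cplx (S.E μ)) *ᵥ (V *ᵥ x)) := by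
    rw [redE_eq, Matrix.star_mulVec, ← Matrix.dotProduct_mulVec]
    simp [Matrix.mul_assoc, Matrix.smul_mulVec, Matrix.mulVec_smul]
  rw [e] at h
  have hcont : ContinuousAt (fun t : ℝ => (S.redD V W μ (Complex.I * t)).det) ω := by
    have : Continuous (fun t : ℝ => S.redD V W μ (Complex.I * t)) := by
      unfold redD; fun_prop
    exact this.matrix_det.continuousAt
  refine h.congr_of_eventuallyEq ?_
  filter_upwards [hcont.eventually_ne hDr] with t ht
  have hD : S.redD V W μ (Complex.I * ω) + ((t - ω : ℝ) : ℂ) • (Complex.I • S.redE V W μ) =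
      S.redD V W μ (Complex.I * t) := by
    simp only [redD, smul_smul]
    rw [sub_add_eq_add_sub, ← add_smul]
    congr 2
    push_cast; ring
  rw [hD, S.redH_of_det_ne_zero ht, Matrix.star_mulVec, Matrix.conjTranspose_conjTranspose,
    ← Matrix.dotProduct_mulVec, Matrix.mulVec_mulVec, Matrix.mulVec_mulVec, Matrix.mul_assoc]

/-- The largest singular value of the reduced transfer function is stationary at an interpolated
peak of the full one. -/
theorem hasDerivAt_redSigma_of_isPeak (hpeak : S.IsPeak μ ω)
    (hDr : (S.redD V W μ (Complex.I * ω)).det ≠ 0)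
    (hV : S.newV μ ω ≤ col V) (hW : S.newW μ ω ≤ col W) (hpos : 0 < S.sigma μ ω)
    (hdiff : DifferentiableAt ℝ (S.redSigma V W μ) ω) :
    HasDerivAt (S.redSigma V W μ) 0 ω := by
  have hD : (S.D μ (Complex.I * ω)).det ≠ 0 := isUnit_iff_ne_zero.1 hpeak.2
  have hHeq := S.redH_eq_H hD hDr hV hW
  obtain ⟨u, v, hu, hv, hHv, hHu⟩ := exists_singular_pair _ hpos
  have hσ : ((svalMax (S.H μ (Complex.I * ω)) : ℝ) : ℂ) ≠ 0 := by exact_mod_cast hpos.ne'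
  obtain ⟨x, hx⟩ : ∃ x, V *ᵥ x = ((S.D μ (Complex.I * ω))⁻¹ * cplx (S.B μ)) *ᵥ v := by
    rcases le_or_gt m p with hmp | hmp
    · rw [newV, if_pos hmp] at hV
      exact exists_mulVec_eq_of_col_le hV v
    -- Here only `D⁻¹BH*` was added, but `v = H*u / σ`, so `D⁻¹Bv` still lies in the space. The left
    -- side below is dual.
    · rw [newV, if_neg hmp.not_ge] at hV
      obtain ⟨x, hx⟩ := exists_mulVec_eq_of_col_le hV
        (((svalMax (S.H μ (Complex.I * ω)) : ℝ) : ℂ)⁻¹ • u)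
      refine ⟨x, ?_⟩
      rw [hx, ← Matrix.mulVec_mulVec, Matrix.mulVec_smul, hHu, smul_smul, inv_mul_cancel₀ hσ,
        one_smul]
  obtain ⟨y, hy⟩ : ∃ y, W *ᵥ y =
      (((S.D μ (Complex.I * ω))⁻¹)ᴴ * (cplx (S.C μ))ᴴ) *ᵥ u := by
    rcases le_or_gt p m with hmp | hmp
    · rw [newW, if_pos hmp] at hW
      exact exists_mulVec_eq_of_col_le hW u
    · rw [newW, if_neg hmp.not_ge] at hW
      obtain ⟨y, hy⟩ := exists_mulVec_eq_of_col_le hW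
        (((svalMax (S.H μ (Complex.I * ω)) : ℝ) : ℂ)⁻¹ • v)
      refine ⟨y, ?_⟩
      rw [hy, ← Matrix.mulVec_mulVec, Matrix.mulVec_smul, hHv, smul_smul, inv_mul_cancel₀ hσ,
        one_smul]
  have hval : ∀ M : Matrix (Fin p) (Fin m) ℂ, (star u ⬝ᵥ (M *ᵥ v)).re ≤ svalMax M := fun M => by
    have := norm_star_dotProduct_mulVec_le M u v
    rw [hu, hv, mul_one, mul_one] at this
    exact (Complex.re_le_norm _).trans this
  have hval0 : (star u ⬝ᵥ (S.H μ (Complex.I * ω) *ᵥ v)).re = S.sigma μ ω := by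
    rw [hHv, dotProduct_smul, star_dotProduct_self, hu]
    simp [sigma]
  have hred := S.hasDerivAt_pairing_redH hDr (S.redD_mulVec_eq hD hx)
    (S.redD_conjTranspose_mulVec_eq hD hy)
  have hone1 : (1 : Matrix (Fin n) (Fin n) ℂ) *ᵥ (V *ᵥ x) =
    ((S.D μ (Complex.I * ω))⁻¹ * cplx (S.B μ)) *ᵥ v := by rw [Matrix.one_mulVec, hx]
  have hone2 : (1 : Matrix (Fin n) (Fin n) ℂ) *ᵥ (W *ᵥ y) =
    (((S.D μ (Complex.I * ω))⁻¹)ᴴ * (cplx (S.C μ))ᴴ) *ᵥ u := by rw [Matrix.one_mulVec, hy]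
  have hfull := S.hasDerivAt_pairing_redH (V := (1 : Matrix (Fin n) (Fin n) ℂ)) (W := 1)
    (by rwa [redD_one]) (S.redD_mulVec_eq hD hone1) (S.redD_conjTranspose_mulVec_eq hD hone2)
  simp only [Matrix.one_mulVec, redH_one] at hfull
  have hredre := Complex.reCLM.hasFDerivAt.comp_hasDerivAt ω hred
  have hfullre := Complex.reCLM.hasFDerivAt.comp_hasDerivAt ω hfull
  -- The frozen pairing is at most `σ(t) ≤ σ(ω)`, with equality at `ω`; hence it is itself maximal
  -- there.
  have hmaxfull : IsLocalMax
      (Complex.reCLM ∘ fun t : ℝ => star u ⬝ᵥ (S.H μ (Complex.I * t) *ᵥ v)) ω :=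
    Eventually.of_forall fun t => by
      change (star u ⬝ᵥ (S.H μ (Complex.I * t) *ᵥ v)).re ≤
        (star u ⬝ᵥ (S.H μ (Complex.I * ω) *ᵥ v)).re
      rw [hval0]
      exact (hval _).trans (hpeak.1 t)
  have hzero := hmaxfull.hasDerivAt_eq_zero hfullre
  rw [hzero] at hredre
  -- The reduced `σ` dominates its pairing and equals it at `ω`, so their derivatives agree.
  have hmin : IsLocalMin (S.redSigma V W μ -
      (Complex.reCLM ∘ fun t : ℝ => star u ⬝ᵥ (S.redH V W μ (Complex.I * t) *ᵥ v))) ω :=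
    Eventually.of_forall fun t => by
      change S.redSigma V W μ ω - (star u ⬝ᵥ (S.redH V W μ (Complex.I * ω) *ᵥ v)).re ≤
        S.redSigma V W μ t - (star u ⬝ᵥ (S.redH V W μ (Complex.I * t) *ᵥ v)).re
      have h1 : S.redSigma V W μ ω = S.sigma μ ω := by rw [redSigma, hHeq, sigma]
      rw [hHeq, hval0, h1, sub_self]
      exact sub_nonneg.2 (hval _)
  have hz := hmin.hasDerivAt_eq_zero (hdiff.hasDerivAt.sub hredre)
  rw [sub_zero] at hz
  rw [← hz]
  exact hdiff.hasDerivAt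

end ParamSystem

end Interpolation

/-! ### Bounded rational functions on the right half-plane -/

section Hardy

/-- Evaluation at a pole returns `0`, so the bound gives no information at the pole itself. It is
used on nearby points to the right, where `|num| ≤ c |denom|`; in the limit the numerator would
vanish too, against coprimality. -/
theorem eval_denom_ne_zero_of_bounded {f : RatFunc ℂ} {c : ℝ}
    (h : ∀ s : ℂ, 0 < s.re → ‖RatFunc.eval (RingHom.id ℂ) s f‖ ≤ c) {s₀ : ℂ} (hs₀ : 0 ≤ s₀.re) :
    f.denom.eval s₀ ≠ 0 := by
  intro h0
  have hnum : f.num.eval s₀ ≠ 0 := by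
    intro h1
    obtain ⟨a, b, hab⟩ := RatFunc.isCoprime_num_denom f
    have := congrArg (Polynomial.eval s₀) hab
    simp [h0, h1] at this
  let γ : ℝ → ℂ := fun t => s₀ + t
  have hγ : Tendsto γ (𝓝[>] 0) (𝓝 s₀) := by
    have : Continuous γ := by fun_prop
    exact (this.tendsto' 0 s₀ (by simp [γ])).mono_left nhdsWithin_le_nhds
  have hfin : {s | s ∈ f.denom.roots.toFinset ∧ s ≠ s₀}.Finite :=
    (Finset.finite_toSet f.denom.roots.toFinset).subset fun s hs => hs.1
  have hne : ∀ᶠ t in 𝓝[>] (0 : ℝ), f.denom.eval (γ t) ≠ 0 := by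
    have h1 : {s | s ∈ f.denom.roots.toFinset ∧ s ≠ s₀}ᶜ ∈ 𝓝 s₀ :=
      hfin.isClosed.isOpen_compl.mem_nhds (by simp)
    filter_upwards [hγ h1, self_mem_nhdsWithin] with t ht ht0 hroot
    apply ht
    refine ⟨by simpa [f.denom_ne_zero] using hroot, ?_⟩
    have : t ≠ 0 := ne_of_gt ht0
    simpa [γ] using this
  have hle : ∀ᶠ t in 𝓝[>] (0 : ℝ), ‖f.num.eval (γ t)‖ ≤ c * ‖f.denom.eval (γ t)‖ := by
    filter_upwards [hne, self_mem_nhdsWithin] with t ht ht0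
    have hre : 0 < (γ t).re := by
      have : 0 < t := ht0
      simp only [γ, Complex.add_re, Complex.ofReal_re]; linarith
    have := h _ hre
    rw [RatFunc.eval, Polynomial.eval₂_id, Polynomial.eval₂_id, norm_div,
      div_le_iff₀ (norm_pos_iff.2 ht)] at this
    exact this
  have l1 : Tendsto (fun t => ‖f.num.eval (γ t)‖) (𝓝[>] 0) (𝓝 ‖f.num.eval s₀‖) :=
    ((f.num.continuous.tendsto s₀).comp hγ).norm
  have l2 : Tendsto (fun t => c * ‖f.denom.eval (γ t)‖) (𝓝[>] 0) (𝓝 (c * ‖f.denom.eval s₀‖)) :=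
    (((f.denom.continuous.tendsto s₀).comp hγ).norm).const_mul c
  have := le_of_tendsto_of_tendsto l1 l2 hle
  rw [h0, norm_zero, mul_zero] at this
  exact hnum (norm_le_zero_iff.1 this)

theorem differentiableAt_ratFunc_eval {f : RatFunc ℂ} {s : ℂ} (h : f.denom.eval s ≠ 0) :
    DifferentiableAt ℂ (fun z => RatFunc.eval (RingHom.id ℂ) z f) s := by
  simp only [RatFunc.eval, Polynomial.eval₂_id]
  exact f.num.differentiable.differentiableAt.div f.denom.differentiable.differentiableAt h

variable {p m : ℕ} {G : Matrix (Fin p) (Fin m) (RatFunc ℂ)} {c : ℝ}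

theorem differentiableAt_evalAt_entry (hG : ∀ s : ℂ, 0 < s.re → svalMax (evalAt G s) ≤ c)
    {s : ℂ} (hs : 0 ≤ s.re) (i : Fin p) (j : Fin m) :
    DifferentiableAt ℂ (fun z => evalAt G z i j) s :=
  differentiableAt_ratFunc_eval (eval_denom_ne_zero_of_bounded (c := c) (fun z hz =>
    (norm_entry_le_svalMax (evalAt G z) i j).trans (hG z hz)) hs)

theorem continuousAt_evalAt (hG : ∀ s : ℂ, 0 < s.re → svalMax (evalAt G s) ≤ c)
    {s : ℂ} (hs : 0 ≤ s.re) : ContinuousAt (evalAt G) s :=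
  continuousAt_pi.2 fun i => continuousAt_pi.2 fun j =>
    (differentiableAt_evalAt_entry hG hs i j).continuousAt

/-- The maximum principle in the right half-plane for transfer functions in the Hardy space. -/
theorem svalMax_evalAt_le_of_imaginary_axis
    (hG : ∀ s : ℂ, 0 < s.re → svalMax (evalAt G s) ≤ c) {b : ℝ}
    (hb : ∀ ω : ℝ, svalMax (evalAt G (Complex.I * ω)) ≤ b) {s : ℂ} (hs : 0 ≤ s.re) :
    svalMax (evalAt G s) ≤ b := by
  have hb0 : 0 ≤ b := (sval_nonneg _ 0).trans (hb 0)
  rcases (sval_nonneg (evalAt G s) 0).eq_or_lt with h0 | h0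
  · exact h0.symm.trans_le hb0
  obtain ⟨u, v, hu, hv, hMv, -⟩ := exists_singular_pair _ h0
  -- Freezing the singular vectors at `s` gives a scalar holomorphic function bounded by the largest
  -- singular value, with equality at `s`.
  let f : ℂ → ℂ := fun z => star u ⬝ᵥ (evalAt G z *ᵥ v)
  have hf : ∀ z : ℂ, 0 ≤ z.re → DifferentiableAt ℂ f z := fun z hz => by
    have e : f = fun z => ∑ i, star u i * ∑ j, evalAt G z i j * v j := rfl
    rw [e]
    exact DifferentiableAt.fun_sum fun i _ => (differentiableAt_const _).mul
      (DifferentiableAt.fun_sum fun j _ =>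
        (differentiableAt_evalAt_entry hG hz i j).mul (differentiableAt_const _))
  have hbound : ∀ z, ‖f z‖ ≤ svalMax (evalAt G z) := fun z => by
    have := norm_star_dotProduct_mulVec_le (evalAt G z) u v
    rwa [hu, hv, mul_one, mul_one] at this
  have hd : DiffContOnCl ℂ f {z | 0 < z.re} := by
    refine ⟨fun z hz => (hf z (le_of_lt hz)).differentiableWithinAt, fun z hz => ?_⟩
    rw [Complex.closure_setOfPred_lt_re] at hz
    exact (hf z hz).continuousAt.continuousWithinAt
  -- Boundedness by `c` in the half-plane supplies the growth conditions, with trivial exponents.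
  have key := PhragmenLindelof.right_half_plane_of_bounded_on_real (f := f) (C := b) hd
    ⟨0, by norm_num, 0, ?_⟩ ?_ (fun x => ?_) hs
  · refine le_trans ?_ key
    have : f s = (svalMax (evalAt G s) : ℂ) := by
      simp only [f]
      rw [hMv, dotProduct_smul, star_dotProduct_self, hu]
      simp
    rw [this, Complex.norm_real]
    exact le_abs_self _
  · refine Asymptotics.IsBigO.of_bound c ?_
    rw [eventually_inf_principal]
    refine Eventually.of_forall fun z hz => ?_
    simpa using (hbound z).trans (hG z hz)
  · refine isBoundedUnder_of_eventually_le (a := c) ?_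
    filter_upwards [eventually_gt_atTop 0] with x hx
    exact (hbound x).trans (hG x (by simpa using hx))
  · rw [mul_comm]
    exact (hbound _).trans (hb x)

/-! ### Hardy norm, symmetry and localization of maximizers for the full system. -/

namespace ParamSystem

variable {d n m p : ℕ} {S : ParamSystem d n m p} {μ : EuclideanSpace ℝ (Fin d)}

theorem InHinf.svalMax_le (h : S.InHinf μ) {s : ℂ} (hs : 0 < s.re) :
    svalMax (S.H μ s) ≤ (S.hInfNorm μ).toReal := by
  have h1 : ENNReal.ofReal (svalMax (S.H μ s)) ≤ S.hInfNorm μ :=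
    le_iSup (fun s : {s : ℂ // 0 < s.re} => ENNReal.ofReal (svalMax (S.H μ s))) ⟨s, hs⟩
  exact (ENNReal.ofReal_le_iff_le_toReal h.2.ne).1 h1

theorem InHinf.continuousAt_H (h : S.InHinf μ) {s : ℂ} (hs : 0 ≤ s.re) :
    ContinuousAt (S.H μ) s :=
  continuousAt_evalAt (c := (S.hInfNorm μ).toReal) (fun _ hz => h.svalMax_le hz) hs

theorem InHinf.continuous_sigma (h : S.InHinf μ) : Continuous (S.sigma μ) := by
  refine continuous_iff_continuousAt.2 fun ω => ?_
  have h1 : ContinuousAt (fun t : ℝ => Complex.I * (t : ℂ)) ω := by fun_prop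
  exact continuous_svalMax.continuousAt.comp
    (ContinuousAt.comp (f := fun t : ℝ => Complex.I * (t : ℂ)) (h.continuousAt_H (by simp)) h1)

theorem InHinf.hInfNorm_eq (h : S.InHinf μ) {w : ℝ} (hw : ∀ ω, S.sigma μ ω ≤ S.sigma μ w) :
    S.hInfNorm μ = ENNReal.ofReal (S.sigma μ w) := by
  apply le_antisymm
  · refine iSup_le fun s => ENNReal.ofReal_le_ofReal ?_
    exact svalMax_evalAt_le_of_imaginary_axis (c := (S.hInfNorm μ).toReal)
      (fun _ hz => h.svalMax_le hz) hw s.2.le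
  -- The supremum runs over the open half-plane, so the boundary value is reached as a limit from
  -- the right.
  · let γ : ℝ → ℂ := fun t => Complex.I * w + t
    have hγ : Tendsto γ (𝓝[>] 0) (𝓝 (Complex.I * w)) := by
      have : Continuous γ := by fun_prop
      exact (this.tendsto' 0 _ (by simp [γ])).mono_left nhdsWithin_le_nhds
    have hlim : Tendsto (fun t => svalMax (S.H μ (γ t))) (𝓝[>] 0) (𝓝 (S.sigma μ w)) :=
      (continuous_svalMax.tendsto _).comp (Tendsto.comp (h.continuousAt_H (by simp)) hγ)
    rw [ENNReal.ofReal_le_iff_le_toReal h.2.ne]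
    refine le_of_tendsto hlim ?_
    filter_upwards [self_mem_nhdsWithin] with t ht
    have ht' : 0 < t := ht
    exact h.svalMax_le (by simpa [γ] using ht')

/-! ### Evenness on the imaginary axis -/

theorem cplx_map_conj {a b : ℕ} (M : Matrix (Fin a) (Fin b) ℝ) :
    (cplx M).map (starRingEnd ℂ) = cplx M := by
  ext; simp [cplx]

theorem svalMax_map_conj {a b : ℕ} (M : Matrix (Fin a) (Fin b) ℂ) :
    svalMax (M.map (starRingEnd ℂ)) = svalMax M := by
  have key : ∀ N : Matrix (Fin a) (Fin b) ℂ, svalMax (N.map (starRingEnd ℂ)) ≤ svalMax N := by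
    intro N
    refine svalMax_le_of_forall _ (sval_nonneg N 0) fun x => ?_
    have h := norm_toEuclideanLin_le N (WithLp.toLp 2 (star x.ofLp))
    have e1 : ‖(WithLp.toLp 2 (star x.ofLp) : EuclideanSpace ℂ (Fin b))‖ = ‖x‖ := by
      simp [EuclideanSpace.norm_eq]
    have e2 : ‖Matrix.toEuclideanLin (N.map (starRingEnd ℂ)) x‖ =
        ‖Matrix.toEuclideanLin N (WithLp.toLp 2 (star x.ofLp))‖ := by
      rw [EuclideanSpace.norm_eq, EuclideanSpace.norm_eq]
      congr 1
      refine Finset.sum_congr rfl fun i _ => ?_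
      have : (Matrix.toEuclideanLin (N.map (starRingEnd ℂ)) x) i =
          starRingEnd ℂ ((Matrix.toEuclideanLin N (WithLp.toLp 2 (star x.ofLp))) i) := by
        simp [Matrix.toLpLin_apply, Matrix.mulVec, dotProduct]
      rw [this, RCLike.norm_conj]
    rw [e1] at h
    rwa [e2]
  refine le_antisymm (key M) ?_
  have := key (M.map (starRingEnd ℂ))
  rwa [Matrix.map_map, show (starRingEnd ℂ : ℂ → ℂ) ∘ (starRingEnd ℂ) = id from by ext; simp,
    Matrix.map_id] at this

/-- As the data are real, conjugation carries `H(iω)` to `H(-iω)` and preserves singular values. -/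
theorem sigma_neg {ω : ℝ} (hD : (S.D μ (Complex.I * ω)).det ≠ 0) :
    S.sigma μ (-ω) = S.sigma μ ω := by
  have e : (S.D μ (Complex.I * ω)).map (starRingEnd ℂ) = S.D μ (Complex.I * (-ω : ℝ)) := by
    ext i j
    simp [D, cplx]
  have hD' : (S.D μ (Complex.I * (-ω : ℝ))).det ≠ 0 := by
    rw [← e, ← RingHom.mapMatrix_apply, ← RingHom.map_det]
    simpa using hD
  have hinv : ((S.D μ (Complex.I * ω))⁻¹).map (starRingEnd ℂ) =
      (S.D μ (Complex.I * (-ω : ℝ)))⁻¹ := by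
    symm
    apply Matrix.inv_eq_left_inv
    rw [← e, ← Matrix.map_mul, Matrix.nonsing_inv_mul _ (isUnit_iff_ne_zero.2 hD)]
    simp
  rw [sigma, sigma, S.H_of_det_ne_zero hD, S.H_of_det_ne_zero hD', ← hinv,
    ← cplx_map_conj (S.C μ), ← cplx_map_conj (S.B μ), ← Matrix.map_mul, ← Matrix.map_mul,
    svalMax_map_conj, cplx_map_conj, cplx_map_conj]

/-! ### Localization of the global maximizers -/

/-- Away from `±w` the strict inequality becomes a uniform one, by compactness of the bounded part
and the assumed bound near infinity. Such a margin survives uniform perturbation. -/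
theorem exists_lt_of_isUniqueMax {s : ℝ → ℝ} (hs : Continuous s) {w b : ℝ} (hb : 0 < b)
    (hmax : IsUniqueMax s w) :
    ∃ c < s w, ∀ ω, ω ∉ closedBall w b → -ω ∉ closedBall w b → s ω ≤ c := by
  obtain ⟨c₁, hc₁, hev⟩ := hmax.2
  obtain ⟨K, hK, hKc⟩ := mem_cocompact.1 hev
  let L : Set ℝ := K \ (ball w b ∪ (fun ω => -ω) ⁻¹' ball w b)
  have hL : IsCompact L := hK.diff (isOpen_ball.union (isOpen_ball.preimage continuous_neg))
  have hcov : ∀ c, c₁ ≤ c → (∀ ω ∈ L, s ω ≤ c) →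
      ∀ ω, ω ∉ closedBall w b → -ω ∉ closedBall w b → s ω ≤ c := by
    intro c hc hLc ω h1 h2
    by_cases hωK : ω ∈ K
    · refine hLc ω ⟨hωK, ?_⟩
      rintro (h | h)
      · exact h1 (ball_subset_closedBall h)
      · exact h2 (ball_subset_closedBall h)
    · exact (hKc hωK : s ω ≤ c₁).trans hc
  rcases L.eq_empty_or_nonempty with hLe | hLn
  · exact ⟨c₁, hc₁, hcov c₁ le_rfl (by simp [hLe])⟩
  · obtain ⟨x, hxL, hx⟩ := hL.exists_isMaxOn hLn hs.continuousOn
    refine ⟨max c₁ (s x), max_lt hc₁ (hmax.1 x fun habs => hxL.2 ?_), hcov _ (le_max_left _ _)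
      fun ω hω => (hx hω).trans (le_max_right _ _)⟩
    rcases abs_eq_abs.1 habs with h | h
    · left; rw [h]; exact mem_ball_self hb
    · right; rw [h]; simpa using hb

/-- Near `μs` the values of `σ(μ, ·)` away from `± ωs` stay below the value at `ωs`. -/
theorem eventually_sigma_lt {μs : EuclideanSpace ℝ (Fin d)} {ωs : ℝ} (hH : S.InHinf μs)
    (hcont : TendstoUniformly S.sigma (S.sigma μs) (𝓝 μs)) (hmax : IsUniqueMax (S.sigma μs) ωs)
    {b : ℝ} (hb : 0 < b) :
    ∀ᶠ μ in 𝓝 μs, ∃ c < S.sigma μ ωs, ∀ ω, ω ∉ closedBall ωs b → -ω ∉ closedBall ωs b →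
      S.sigma μ ω ≤ c := by
  obtain ⟨c, hc, hcb⟩ := exists_lt_of_isUniqueMax hH.continuous_sigma hb hmax
  filter_upwards [Metric.tendstoUniformly_iff.1 hcont ((S.sigma μs ωs - c) / 3) (by linarith)]
    with μ hμ
  refine ⟨c + (S.sigma μs ωs - c) / 3, ?_, fun ω h1 h2 => ?_⟩
  · have := abs_lt.1 (by simpa [Real.dist_eq] using hμ ωs)
    linarith [this.1, this.2]
  · have := abs_lt.1 (by simpa [Real.dist_eq] using hμ ω)
    linarith [this.1, this.2, hcb ω h1 h2]

/-- Values near `ωs` lose to the local maximum, values near `-ωs` do so by evenness, and far values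
lie below the value at `ωs`, which the local maximum dominates. -/
theorem isUniqueMax_of_local {ωs b w : ℝ} (hb : 0 ≤ b)
    (hw : ∀ ω ∈ closedBall ωs b, ω ≠ w → S.sigma μ ω < S.sigma μ w)
    (hD : ∀ ω ∈ closedBall ωs b, (S.D μ (Complex.I * ω)).det ≠ 0)
    (hfar : ∃ c < S.sigma μ ωs, ∀ ω, ω ∉ closedBall ωs b → -ω ∉ closedBall ωs b →
      S.sigma μ ω ≤ c) : IsUniqueMax (S.sigma μ) w := by
  obtain ⟨c, hc, hfar⟩ := hfar
  have hle : S.sigma μ ωs ≤ S.sigma μ w := by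
    by_cases h : ωs = w
    · rw [h]
    · exact (hw ωs (mem_closedBall_self hb) h).le
  refine ⟨fun ω hω => ?_, c, hc.trans_le hle, ?_⟩
  · by_cases h1 : ω ∈ closedBall ωs b
    · exact hw ω h1 (fun h => hω (by rw [h]))
    · by_cases h2 : -ω ∈ closedBall ωs b
      · have := sigma_neg (hD (-ω) h2)
        rw [neg_neg] at this
        rw [this]
        exact hw (-ω) h2 (fun h => hω (by rw [← h, abs_neg]))
      · exact ((hfar ω h1 h2).trans_lt hc).trans_le hle
  · have hK : IsCompact (closedBall ωs b ∪ (fun ω => -ω) ⁻¹' closedBall ωs b) := by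
      refine (isCompact_closedBall ωs b).union ?_
      exact (Homeomorph.neg ℝ).isCompact_preimage.2 (isCompact_closedBall ωs b)
    refine mem_cocompact.2 ⟨_, hK, fun ω hω => ?_⟩
    rw [mem_compl_iff, mem_union, not_or] at hω
    exact hfar ω hω.1 hω.2

/-- The far estimate leaves `ω` or `-ω` near `ωs`; the sign condition makes `ω` the closer of the
two. -/
theorem mem_closedBall_of_maximizer {ωs b ω : ℝ} (hsign : 0 ≤ ω * ωs)
    (hω : ∀ ω', S.sigma μ ω' ≤ S.sigma μ ω)
    (hfar : ∃ c < S.sigma μ ωs, ∀ ω, ω ∉ closedBall ωs b → -ω ∉ closedBall ωs b →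
      S.sigma μ ω ≤ c) : ω ∈ closedBall ωs b := by
  obtain ⟨c, hc, hfar⟩ := hfar
  by_contra h1
  by_cases h2 : -ω ∈ closedBall ωs b
  · apply h1
    rw [mem_closedBall, Real.dist_eq] at *
    refine le_trans (sq_le_sq.1 ?_) h2
    nlinarith
  · linarith [hfar ω h1 h2, hω ωs]

end ParamSystem

end Hardy

/-! ### Compact families of projection matrices -/

section Families

attribute [local instance] Matrix.normedAddCommGroup Matrix.normedSpace

theorem eventually_forall_closedBall {M : Type*} [PseudoMetricSpace M] {x : M} {P : M → Prop}
    (h : ∀ᶠ y in 𝓝 x, P y) : ∀ᶠ a in 𝓝[>] (0 : ℝ), ∀ y ∈ closedBall x a, P y := by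
  obtain ⟨r, hr, hP⟩ := (nhds_basis_closedBall (x := x)).eventually_iff.1 h
  filter_upwards [mem_nhdsWithin_of_mem_nhds (Iic_mem_nhds hr)] with a ha y hy
  exact hP (closedBall_subset_closedBall ha hy)

theorem continuousAt_deriv_deriv_snd {X : Type*} [NormedAddCommGroup X] [NormedSpace ℝ X]
    {F : X × ℝ → ℝ} {z : X × ℝ} (h : ContDiffAt ℝ 4 F z) :
    ContinuousAt (fun y : X × ℝ => deriv (deriv fun t => F (y.1, t)) y.2) z := by
  have h1 : ContDiffAt ℝ 3 (fun y : X × ℝ => deriv (fun t => F (y.1, t)) y.2) z :=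
    contDiffAt_deriv_snd (n := 3) (by convert h using 1; norm_num)
  exact (contDiffAt_deriv_snd (n := 2) (F := fun y : X × ℝ => deriv (fun t => F (y.1, t)) y.2)
    (by convert h1 using 1; norm_num)).continuousAt

theorem norm_le_one_of_conjTranspose_mul_self {n r : ℕ} {V : Matrix (Fin n) (Fin r) ℂ}
    (h : Vᴴ * V = 1) : ‖V‖ ≤ 1 := by
  refine (Matrix.norm_le_iff zero_le_one).2 fun i j => ?_
  have h1 := congrFun (congrFun h j) j
  rw [Matrix.mul_apply, Matrix.one_apply_eq] at h1
  have h2 : ∑ k, ‖V k j‖ ^ 2 = 1 := by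
    have h3 : ∀ k, Vᴴ j k * V k j = ((‖V k j‖ ^ 2 : ℝ) : ℂ) := fun k => by
      rw [Matrix.conjTranspose_apply]
      push_cast
      exact Complex.conj_mul' _
    simp_rw [h3] at h1
    exact_mod_cast h1
  have h4 : ‖V i j‖ ^ 2 ≤ 1 := h2 ▸
    Finset.single_le_sum (f := fun k => ‖V k j‖ ^ 2) (fun k _ => by positivity) (Finset.mem_univ i)
  exact (sq_le_one_iff₀ (norm_nonneg _)).1 h4

/-- Only finitely many sizes of reduced systems occur, so radii can be made uniform in the size as
well. -/
theorem le_of_conjTranspose_mul_self {n r : ℕ} {V : Matrix (Fin n) (Fin r) ℂ}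
    (h : Vᴴ * V = 1) : r ≤ n := by
  have hinj : Function.Injective V.mulVecLin := fun x y hxy => by
    have h1 : V *ᵥ x = V *ᵥ y := hxy
    have h2 := congrArg (fun z => Vᴴ *ᵥ z) h1
    simpa [Matrix.mulVec_mulVec, h] using h2
  simpa using LinearMap.finrank_le_finrank_of_injective hinj

namespace ParamSystem

variable {d n m p : ℕ} (S : ParamSystem d n m p) (μs : EuclideanSpace ℝ (Fin d)) (ωs : ℝ)

/-- Pairs of matrices with orthonormal columns for which the reduced pencil at the base point is
bounded below by `β`. -/
def stablePairs (β : ℝ) (r : ℕ) : Set (Matrix (Fin n) (Fin r) ℂ × Matrix (Fin n) (Fin r) ℂ) :=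
  {q | (q.1ᴴ * q.1 = 1 ∧ q.2ᴴ * q.2 = 1) ∧
    ∀ x, β * ‖x‖ ≤ ‖Matrix.toEuclideanLin (S.redD q.1 q.2 μs (Complex.I * ωs)) x‖}

/-- Stable pairs for which, at the base point, the largest singular value is separated by `γ` from
the others and has second derivative at most `δ`. -/
def peakedPairs (β γ δ : ℝ) (r : ℕ) :
    Set (Matrix (Fin n) (Fin r) ℂ × Matrix (Fin n) (Fin r) ℂ) :=
  {q ∈ {q ∈ S.stablePairs μs ωs β r | S.redGap q μs ωs ∈ Ici γ} |
    deriv (deriv (S.redSigma q.1 q.2 μs)) ωs ∈ Iic δ}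

variable {S μs ωs} {β γ δ : ℝ} {r : ℕ}

theorem isCompact_stablePairs : IsCompact (S.stablePairs μs ωs β r) := by
  have : ProperSpace (Matrix (Fin n) (Fin r) ℂ) :=
    inferInstanceAs (ProperSpace (Fin n → Fin r → ℂ))
  have hclosed : IsClosed (S.stablePairs μs ωs β r) := by
    have hbound : IsClosed {q : Matrix (Fin n) (Fin r) ℂ × Matrix (Fin n) (Fin r) ℂ |
        ∀ x, β * ‖x‖ ≤ ‖Matrix.toEuclideanLin (S.redD q.1 q.2 μs (Complex.I * ωs)) x‖} := by
      simp only [ofPred_forall]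
      refine isClosed_iInter fun x => isClosed_le continuous_const ?_
      have h1 : Continuous fun q : Matrix (Fin n) (Fin r) ℂ × Matrix (Fin n) (Fin r) ℂ =>
          S.redD q.1 q.2 μs (Complex.I * ωs) := by
        simp only [redD_eq]
        exact (continuous_snd.matrix_conjTranspose.matrix_mul continuous_const).matrix_mul
          continuous_fst
      have h2 := continuous_toEuclideanCLM.comp h1
      exact (h2.clm_apply continuous_const).norm
    refine IsClosed.inter (IsClosed.inter ?_ ?_) hbound
    · exact isClosed_eq (continuous_fst.matrix_conjTranspose.matrix_mul continuous_fst)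
        continuous_const
    · exact isClosed_eq (continuous_snd.matrix_conjTranspose.matrix_mul continuous_snd)
        continuous_const
  refine ((isCompact_closedBall (0 : Matrix (Fin n) (Fin r) ℂ) 1).prod
    (isCompact_closedBall (0 : Matrix (Fin n) (Fin r) ℂ) 1)).of_isClosed_subset hclosed ?_
  intro q hq
  exact ⟨by simpa using norm_le_one_of_conjTranspose_mul_self hq.1.1,
    by simpa using norm_le_one_of_conjTranspose_mul_self hq.1.2⟩

theorem det_ne_zero_of_forall_le {M : Matrix (Fin r) (Fin r) ℂ} (hβ : 0 < β)
    (h : ∀ x, β * ‖x‖ ≤ ‖Matrix.toEuclideanLin M x‖) : M.det ≠ 0 := by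
  intro h0
  obtain ⟨v, hv, hMv⟩ := Matrix.exists_mulVec_eq_zero_iff.2 h0
  have h1 := h (WithLp.toLp 2 v)
  have h2 : Matrix.toEuclideanLin M (WithLp.toLp 2 v) = WithLp.toLp 2 (M *ᵥ v) := rfl
  rw [h2, hMv, WithLp.toLp_zero, norm_zero] at h1
  have h3 : 0 < ‖WithLp.toLp 2 v‖ := norm_pos_iff.2 (by simpa using hv)
  nlinarith

theorem contDiffAt_redSigma_of_mem (hμ : μs ∈ S.Ω) (hβ : 0 < β) (hγ : 0 < γ)
    {q : Matrix (Fin n) (Fin r) ℂ × Matrix (Fin n) (Fin r) ℂ}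
    (hq : q ∈ S.stablePairs μs ωs β r) (hg : γ ≤ S.redGap q μs ωs) :
    ContDiffAt ℝ 4 (fun y : ReducedPoint d n r => S.redSigma y.1.1.1 y.1.1.2 y.1.2 y.2)
      ((q, μs), ωs) :=
  S.contDiffAt_redSigma ((q, μs), ωs) hμ (det_ne_zero_of_forall_le hβ hq.2)
    (sub_pos.1 (hγ.trans_le hg)) (by norm_num)

/-- Two stages are needed: the gap is continuous on stable pairs, whereas continuity of the second
derivative is available only once the gap is bounded below. -/
theorem isCompact_peakedPairs (hμ : μs ∈ S.Ω) (hβ : 0 < β) (hγ : 0 < γ) :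
    IsCompact (S.peakedPairs μs ωs β γ δ r) := by
  have h1 : IsCompact {q ∈ S.stablePairs μs ωs β r | S.redGap q μs ωs ∈ Ici γ} := by
    refine isCompact_stablePairs.of_isClosed_subset ?_ (fun q hq => hq.1)
    refine ContinuousOn.preimage_isClosed_of_isClosed (fun q hq => ?_)
      isCompact_stablePairs.isClosed isClosed_Ici
    have h := S.continuousAt_redGap ((q, μs), ωs) hμ (det_ne_zero_of_forall_le hβ hq.2)
    exact (ContinuousAt.comp (x := q) (f := fun q' => (((q', μs), ωs) : ReducedPoint d n r)) h
      (by fun_prop)).continuousWithinAt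
  refine h1.of_isClosed_subset ?_ (fun q hq => hq.1)
  refine ContinuousOn.preimage_isClosed_of_isClosed (fun q hq => ?_) h1.isClosed
    (isClosed_Iic (a := δ))
  have h := continuousAt_deriv_deriv_snd (contDiffAt_redSigma_of_mem hμ hβ hγ hq.1 hq.2)
  exact (ContinuousAt.comp (x := q) (f := fun q' => (((q', μs), ωs) : ReducedPoint d n r)) h
    (by fun_prop)).continuousWithinAt

/-- No gap is required of the pairs here; this is what carries the gap from the interpolation point
to the base point. -/
theorem eventually_redGap_near (hμ : μs ∈ S.Ω) (hβ : 0 < β) {η : ℝ} (hη : 0 < η) :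
    ∀ᶠ z : EuclideanSpace ℝ (Fin d) × ℝ in 𝓝 (μs, ωs), ∀ q ∈ S.stablePairs μs ωs β r,
      (S.redD q.1 q.2 z.1 (Complex.I * z.2)).det ≠ 0 ∧
        |S.redGap q z.1 z.2 - S.redGap q μs ωs| < η := by
  refine isCompact_stablePairs.eventually_forall_of_forall_eventually
    (P := fun (z : EuclideanSpace ℝ (Fin d) × ℝ)
      (q : Matrix (Fin n) (Fin r) ℂ × Matrix (Fin n) (Fin r) ℂ) =>
      (S.redD q.1 q.2 z.1 (Complex.I * z.2)).det ≠ 0 ∧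
        |S.redGap q z.1 z.2 - S.redGap q μs ωs| < η) fun q hq => ?_
  have hdet := det_ne_zero_of_forall_le hβ hq.2
  have hc : ContinuousAt (fun y : (EuclideanSpace ℝ (Fin d) × ℝ) ×
      (Matrix (Fin n) (Fin r) ℂ × Matrix (Fin n) (Fin r) ℂ) =>
      (((y.2, y.1.1), y.1.2) : ReducedPoint d n r)) ((μs, ωs), q) := by fun_prop
  have hc' : ContinuousAt (fun y : (EuclideanSpace ℝ (Fin d) × ℝ) ×
      (Matrix (Fin n) (Fin r) ℂ × Matrix (Fin n) (Fin r) ℂ) =>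
      (((y.2, μs), ωs) : ReducedPoint d n r)) ((μs, ωs), q) := by fun_prop
  have hG := S.continuousAt_redGap ((q, μs), ωs) hμ hdet
  have e1 := hc.eventually (S.eventually_det_redD_ne_zero ((q, μs), ωs) hμ hdet)
  have c1 := ContinuousAt.comp (x := ((μs, ωs), q)) hG hc
  have c2 := ContinuousAt.comp (x := ((μs, ωs), q)) hG hc'
  have e2 := (c1.sub c2).abs.eventually_lt continuousAt_const
    (show _ < η by rw [Pi.sub_apply]; simpa using hη)
  exact e1.and e2

/-- The stationary branches of the reduced systems exist on balls whose radii depend neither on the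
projection matrices nor on their size. -/
theorem eventually_exists_branch (hμ : μs ∈ S.Ω) (hβ : 0 < β) (hγ : 0 < γ) (hδ : δ < 0) :
    ∀ᶠ b in 𝓝[>] (0 : ℝ), ∀ᶠ a in 𝓝[>] (0 : ℝ), ∀ r ∈ Iic n,
      ∀ q ∈ S.peakedPairs μs ωs β γ δ r, ∀ μ₀ ∈ closedBall μs a,
      ∀ ω₀ ∈ closedBall ωs (b / 2), HasDerivAt (S.redSigma q.1 q.2 μ₀) 0 ω₀ →
      ∃ w, IsUniqueStationaryBranch (S.redSigma q.1 q.2) μs ωs a b μ₀ ω₀ w ∧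
        ∀ μ ∈ closedBall μs a, SecondDerivLE (S.redSigma q.1 q.2 μ) (w μ) (δ / 2) ∧
          (∀ ω ∈ closedBall ωs b, ω ≠ w μ →
            S.redSigma q.1 q.2 μ ω < S.redSigma q.1 q.2 μ (w μ)) ∧
          ∀ ω ∈ closedBall ωs b, HasDerivAt (S.redSigma q.1 q.2 μ) 0 ω → ω = w μ := by
  have key : ∀ r ∈ Iic n, _ := fun r _ =>
    exists_uniform_branch
      (fun (q : Matrix (Fin n) (Fin r) ℂ × Matrix (Fin n) (Fin r) ℂ) μ ω => S.redSigma q.1 q.2 μ ω)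
      (isCompact_peakedPairs (δ := δ) hμ hβ hγ) μs ωs δ hδ
      (fun q hq => contDiffAt_redSigma_of_mem hμ hβ hγ hq.1.1 hq.1.2) (fun q hq => hq.2)
  filter_upwards [(eventually_all_finite (finite_Iic n)).2 key] with b hb
  exact (eventually_all_finite (finite_Iic n)).2 hb

/-- For the full system, stability of the base point is the bound on its pencil. -/
theorem one_mem_stablePairs (hβ : β ≤ svalMin (S.D μs (Complex.I * ωs))) :
    ((1, 1) : Matrix (Fin n) (Fin n) ℂ × Matrix (Fin n) (Fin n) ℂ) ∈ S.stablePairs μs ωs β n := by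
  refine ⟨⟨by simp, by simp⟩, fun x => ?_⟩
  rw [redD_one]
  exact le_trans (by gcongr) (svalMin_mul_norm_le _ x)

theorem mem_stablePairs {V W : Matrix (Fin n) (Fin r) ℂ} (hV : Vᴴ * V = 1) (hW : Wᴴ * W = 1)
    (hβ : β ≤ svalMin (S.redD V W μs (Complex.I * ωs))) :
    (V, W) ∈ S.stablePairs μs ωs β r :=
  ⟨⟨hV, hW⟩, fun x => le_trans (by gcongr) (svalMin_mul_norm_le _ x)⟩

theorem redGap_one (μ : EuclideanSpace ℝ (Fin d)) (ω : ℝ) :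
    S.redGap ((1, 1) : Matrix (Fin n) (Fin n) ℂ × Matrix (Fin n) (Fin n) ℂ) μ ω =
      S.sigma μ ω - S.sigmaSecond μ ω := by
  rw [redGap, redSigma_one, redSigmaSecond_one]

end ParamSystem

/-! ### Subspaces of the algorithms -/

theorem Run.interpolates {d n m p : ℕ} {S : ParamSystem d n m p} {R : Run d n}
    {K : Set (EuclideanSpace ℝ (Fin d))} {k : ℕ} (hk : 1 ≤ k)
    (h : R.IsBasic S K k ∨ R.IsExtended S K k) :
    R.Orthonormal k ∧ R.μ k ∈ K ∧ S.IsPeak (R.μ k) (R.ω k) ∧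
      S.newV (R.μ k) (R.ω k) ≤ col (R.V k) ∧ S.newW (R.μ k) (R.ω k) ≤ col (R.W k) := by
  rcases h with ⟨ho, h⟩ | ⟨ho, h⟩
  · obtain ⟨hs, hV, hW⟩ := h k hk le_rfl
    exact ⟨ho k le_rfl, hs.1, hs.2.2, hV ▸ le_sup_right, hW ▸ le_sup_right⟩
  · obtain ⟨hs, -, hV, hW⟩ := h k hk le_rfl
    exact ⟨ho k le_rfl, hs.1, hs.2.2, hV ▸ le_sup_of_le_left le_sup_right,
      hW ▸ le_sup_of_le_left le_sup_right⟩

end Families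

end HinfMin

/-! ### Choice of the constants and proof of the proposition. -/

theorem proposition3p4 {d n m p : ℕ} (S : ParamSystem d n m p)
    -- the compact parameter set, on which (and near the minimizer) the transfer function is in the Hardy space
    (K : Set (EuclideanSpace ℝ (Fin d))) (hK : IsCompact K) (hKΩ : K ⊆ S.Ω)
    (hHinf : ∀ μ ∈ K, S.InHinf μ)
    (μs : EuclideanSpace ℝ (Fin d)) (hμs : μs ∈ K) (hmin : IsLocalMinOn S.hInfNorm K μs)
    (hHinf_near : ∀ᶠ μ in 𝓝 μs, S.InHinf μ)
    (hcont : TendstoUniformly S.sigma (S.sigma μs) (𝓝 μs))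
    -- the smoothness assumption
    (ωs : ℝ) (hmax : IsUniqueMax (S.sigma μs) ωs)
    (hpos : 0 < S.sigma μs ωs) (hsimple : S.sigmaSecond μs ωs < S.sigma μs ωs)
    -- a family of runs of the algorithms with `μ^(k) → μs` as `μ^(1) → μs`
    (k : ℕ) (hk : 1 ≤ k) {ι : Type*} (R : ι → Run d n)
    (hR : ∀ i, (R i).IsBasic S K k ∨ (R i).IsExtended S K k)
    (hsign : ∀ i, 0 ≤ (R i).ω k * ωs)
    (hconv : Tendsto (fun i => (R i).μ k) (comap (fun i => (R i).μ 1) (𝓝 μs)) (𝓝 μs))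
    (δ β : ℝ) (hδ : δ < 0) (hβ : 0 < β)
    (hδ_full : deriv (deriv (S.sigma μs)) ωs ≤ δ)
    (hβ_full : β ≤ svalMin (S.D μs (Complex.I * ωs))) :
    ∃ ρ > 0, ∃ ημ > 0, ∃ ηω > 0, ∃ ε > 0,
      closedBall μs ημ ⊆ S.Ω ∧
      (∃ w : EuclideanSpace ℝ (Fin d) → ℝ,
        IsUniqueStationaryBranch S.sigma μs ωs ημ ηω μs ωs w ∧
        ∀ μ ∈ closedBall μs ημ,
          SecondDerivLE (S.sigma μ) (w μ) (δ / 2) ∧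
          ε ≤ S.sigma μ (w μ) - S.sigmaSecond μ (w μ) ∧
          IsUniqueMax (S.sigma μ) (w μ) ∧ (ωs = 0 → w μ = 0) ∧
          S.hInfNorm μ = ENNReal.ofReal (S.sigma μ (w μ))) ∧
      ∀ i, dist ((R i).μ 1) μs < ρ →
        deriv (deriv (S.redSigma ((R i).V k) ((R i).W k) μs)) ωs ≤ δ →
        β ≤ svalMin (S.redD ((R i).V k) ((R i).W k) μs (Complex.I * ωs)) →
        ∃ w : EuclideanSpace ℝ (Fin d) → ℝ,
          IsUniqueStationaryBranch (S.redSigma ((R i).V k) ((R i).W k)) μs ωs ημ ηω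
            ((R i).μ k) ((R i).ω k) w ∧
          ∀ μ ∈ closedBall μs ημ,
            SecondDerivLE (S.redSigma ((R i).V k) ((R i).W k) μ) (w μ) (δ / 2) ∧
            ε ≤ S.redSigma ((R i).V k) ((R i).W k) μ (w μ) -
              S.redSigmaSecond ((R i).V k) ((R i).W k) μ (w μ) ∧
            (∀ ω ∈ closedBall ωs ηω, ω ≠ w μ →
              S.redSigma ((R i).V k) ((R i).W k) μ ω <
                S.redSigma ((R i).V k) ((R i).W k) μ (w μ)) ∧
            ∀ ω ∈ closedBall ωs ηω,
              HasDerivAt (S.redSigma ((R i).V k) ((R i).W k) μ) 0 ω → ω = w μ := by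
  have hμΩ : μs ∈ S.Ω := hKΩ hμs
  set g := S.sigma μs ωs - S.sigmaSecond μs ωs with hg
  have hg0 : 0 < g := sub_pos.2 hsimple
  have hone : ((1, 1) : Matrix (Fin n) (Fin n) ℂ × Matrix (Fin n) (Fin n) ℂ) ∈
      S.stablePairs μs ωs β n := ParamSystem.one_mem_stablePairs hβ_full
  have hpeak1 : ((1, 1) : Matrix (Fin n) (Fin n) ℂ × Matrix (Fin n) (Fin n) ℂ) ∈
      S.peakedPairs μs ωs β (g / 2) δ n := by
    refine ⟨⟨hone, ?_⟩, ?_⟩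
    · rw [mem_Ici, ParamSystem.redGap_one]; linarith
    · rw [mem_Iic, S.redSigma_one]; exact hδ_full
  -- uniform branches
  have hbranch := ParamSystem.eventually_exists_branch (S := S) (ωs := ωs) hμΩ hβ
    (half_pos hg0) hδ
  -- uniform gap
  obtain ⟨ρ₀, hρ₀, hgap⟩ := exists_box_of_eventually
    ((eventually_all_finite (finite_Iic n)).2 fun r _ =>
      ParamSystem.eventually_redGap_near (S := S) (ωs := ωs) (r := r) hμΩ hβ
        (show 0 < g / 4 by positivity))
  have hle : ∀ᶠ b in 𝓝[>] (0 : ℝ), b ≤ ρ₀ := mem_nhdsWithin_of_mem_nhds (Iic_mem_nhds hρ₀)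
  -- The frequency radius is fixed first; the admissible parameter radii `a` depend on it.
  obtain ⟨b, hbranch, hbρ, hb0⟩ := (hbranch.and (hle.and self_mem_nhdsWithin)).exists
  replace hb0 : 0 < b := hb0
  have hH := hHinf μs hμs
  have hnear := (eventually_forall_closedBall (S.isOpen_Ω.mem_nhds hμΩ)).and
    (eventually_forall_closedBall (hHinf_near.and
      (ParamSystem.eventually_sigma_lt hH hcont hmax hb0)))
  obtain ⟨a, hbranch, ⟨haΩ, hafar⟩, haρ, ha0⟩ := (hbranch.and (hnear.and
    (hle.and self_mem_nhdsWithin))).exists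
  replace ha0 : 0 < a := ha0
  have hgap' : ∀ μ ∈ closedBall μs a, ∀ ω ∈ closedBall ωs b, ∀ r ∈ Iic n,
      ∀ q ∈ S.stablePairs μs ωs β r, (S.redD q.1 q.2 μ (Complex.I * ω)).det ≠ 0 ∧
        |S.redGap q μ ω - S.redGap q μs ωs| < g / 4 := fun μ hμ ω hω =>
    hgap μ (closedBall_subset_closedBall haρ hμ) ω (closedBall_subset_closedBall hbρ hω)
  have hdet1 : ∀ μ ∈ closedBall μs a, ∀ ω ∈ closedBall ωs b,
      (S.D μ (Complex.I * ω)).det ≠ 0 := fun μ hμ ω hω => by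
    have := (hgap' μ hμ ω hω n self_mem_Iic _ hone).1
    rwa [S.redD_one] at this
  have hgap1 : ∀ μ ∈ closedBall μs a, ∀ ω ∈ closedBall ωs b,
      |S.sigma μ ω - S.sigmaSecond μ ω - g| < g / 4 := fun μ hμ ω hω => by
    have := (hgap' μ hμ ω hω n self_mem_Iic _ hone).2
    rwa [ParamSystem.redGap_one, ParamSystem.redGap_one] at this
  have hgapε : ∀ r ∈ Iic n, ∀ q ∈ S.peakedPairs μs ωs β (g / 2) δ r, ∀ μ ∈ closedBall μs a,
      ∀ ω ∈ closedBall ωs b,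
      g / 4 ≤ S.redSigma q.1 q.2 μ ω - S.redSigmaSecond q.1 q.2 μ ω := by
    intro r hr q hq μ hμ ω hω
    have h1 := abs_lt.1 (hgap' μ hμ ω hω r hr q hq.1.1).2
    have h2 : g / 2 ≤ S.redGap q μs ωs := hq.1.2
    have h3 : S.redGap q μ ω = S.redSigma q.1 q.2 μ ω - S.redSigmaSecond q.1 q.2 μ ω := rfl
    linarith [h1.1]
  have hμsa : μs ∈ closedBall μs a := mem_closedBall_self ha0.le
  have hωsb : ωs ∈ closedBall ωs b := mem_closedBall_self hb0.le
  have hmaxs : ∀ ω, S.sigma μs ω ≤ S.sigma μs ωs := fun ω => by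
    by_cases h : |ω| = |ωs|
    · rcases abs_eq_abs.1 h with h | h
      · rw [h]
      · rw [h, ParamSystem.sigma_neg (hdet1 μs hμsa ωs hωsb)]
    · exact (hmax.1 ω h).le
  -- differentiability in the frequency
  have hdiff : ∀ r ∈ Iic n, ∀ q ∈ S.peakedPairs μs ωs β (g / 2) δ r, ∀ μ ∈ closedBall μs a,
      ∀ ω ∈ closedBall ωs b, DifferentiableAt ℝ (S.redSigma q.1 q.2 μ) ω := by
    intro r hr q hq μ hμ ω hω
    exact S.differentiableAt_redSigma (haΩ μ hμ) (hgap' μ hμ ω hω r hr q hq.1.1).1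
      (by linarith [hgapε r hr q hq μ hμ ω hω])
  -- the run-dependent radius
  have hball : ∀ᶠ μ in 𝓝 μs, μ ∈ closedBall μs a := closedBall_mem_nhds μs ha0
  have hruns : ∀ᶠ μ in 𝓝 μs, μ ∈ closedBall μs a ∧ ∃ c < S.sigma μ ωs, ∀ ω,
      ω ∉ closedBall ωs (b / 2) → -ω ∉ closedBall ωs (b / 2) → S.sigma μ ω ≤ c :=
    hball.and (ParamSystem.eventually_sigma_lt hH hcont hmax (half_pos hb0))
  -- A basis of the `comap` filter provides one `ρ` for the whole family. The far estimate was taken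
  -- with `b / 2` since the branch lemma wants its initial frequency in the half interval.
  obtain ⟨ρ, hρ, hruns⟩ := ((nhds_basis_ball.comap _).eventually_iff).1 (hconv hruns)
  refine ⟨ρ, hρ, a, ha0, b, hb0, g / 4, by positivity, haΩ, ?_, ?_⟩
  · have hst : HasDerivAt (S.sigma μs) 0 ωs := by
      have h1 := hdiff n self_mem_Iic _ hpeak1 μs hμsa ωs hωsb
      rw [S.redSigma_one] at h1
      have h2 : IsLocalMax (S.sigma μs) ωs := Eventually.of_forall hmaxs
      rw [← h2.deriv_eq_zero]
      exact h1.hasDerivAt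
    have hfull := hbranch n self_mem_Iic _ hpeak1 μs hμsa ωs
      (mem_closedBall_self (half_pos hb0).le)
    rw [S.redSigma_one] at hfull
    obtain ⟨w, hw, hprop⟩ := hfull hst
    refine ⟨w, hw, fun μ hμ => ?_⟩
    obtain ⟨h2, hloc, -⟩ := hprop μ hμ
    have hwμ := hw.1.mapsTo hμ
    have humax : IsUniqueMax (S.sigma μ) (w μ) :=
      ParamSystem.isUniqueMax_of_local hb0.le hloc (hdet1 μ hμ) (hafar μ hμ).2
    -- By evenness `-w μ` would be a second maximizer in the symmetric interval.
    have hzero : ωs = 0 → w μ = 0 := by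
      rintro rfl
      by_contra hne
      have hlt := hloc (-w μ) (by simpa using hwμ) (by rwa [Ne, neg_eq_self])
      rw [ParamSystem.sigma_neg (hdet1 μ hμ _ hwμ)] at hlt
      exact lt_irrefl _ hlt
    refine ⟨h2, ?_, humax, hzero, (hafar μ hμ).1.hInfNorm_eq fun ω => ?_⟩
    · have := abs_lt.1 (hgap1 μ hμ _ hwμ)
      linarith [this.1]
    · by_cases h : |ω| = |w μ|
      · rcases abs_eq_abs.1 h with h | h
        · rw [h]
        · rw [h, ParamSystem.sigma_neg (hdet1 μ hμ _ hwμ)]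
      · exact (humax.1 ω h).le
  · intro i hi hδi hβi
    obtain ⟨horth, hμK, hpeak, hV, hW⟩ := Run.interpolates hk (hR i)
    obtain ⟨hμa, hfar⟩ := hruns (show i ∈ _ from hi)
    have hωb2 : (R i).ω k ∈ closedBall ωs (b / 2) :=
      ParamSystem.mem_closedBall_of_maximizer (hsign i) hpeak.1 hfar
    have hωb : (R i).ω k ∈ closedBall ωs b :=
      closedBall_subset_closedBall (half_le_self hb0.le) hωb2
    have hr : (R i).r k ∈ Iic n := le_of_conjTranspose_mul_self horth.1
    have hstable := ParamSystem.mem_stablePairs horth.1 horth.2 hβi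
    obtain ⟨hDr, hnear⟩ := hgap' _ hμa _ hωb _ hr _ hstable
    have hHeq := S.redH_eq_H (isUnit_iff_ne_zero.1 hpeak.2) hDr hV hW
    have hgeq : S.redGap ((R i).V k, (R i).W k) ((R i).μ k) ((R i).ω k) =
        S.sigma ((R i).μ k) ((R i).ω k) - S.sigmaSecond ((R i).μ k) ((R i).ω k) := by
      simp only [ParamSystem.redGap, ParamSystem.redSigma, ParamSystem.redSigmaSecond, hHeq,
        ParamSystem.sigma, ParamSystem.sigmaSecond]
    have hg1 := abs_lt.1 (hgap1 _ hμa _ hωb)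
    rw [hgeq] at hnear
    have hg2 := abs_lt.1 hnear
    -- At the iterate the full gap exceeds `g - g/4` and equals the reduced one; the move to the
    -- base point costs another `g/4`, which leaves `g/2`.
    have hpk : ((R i).V k, (R i).W k) ∈ S.peakedPairs μs ωs β (g / 2) δ ((R i).r k) :=
      ⟨⟨hstable, mem_Ici.2 (by linarith [hg1.1, hg2.2])⟩, hδi⟩
    have hpos' : 0 < S.sigma ((R i).μ k) ((R i).ω k) := by
      have : 0 ≤ S.sigmaSecond ((R i).μ k) ((R i).ω k) := sval_nonneg _ 1
      linarith [hg1.1]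
    obtain ⟨w, hw, hprop⟩ := hbranch _ hr _ hpk _ hμa _ hωb2
      (S.hasDerivAt_redSigma_of_isPeak hpeak hDr hV hW hpos' (hdiff _ hr _ hpk _ hμa _ hωb))
    refine ⟨w, hw, fun μ hμ => ?_⟩
    obtain ⟨h2, hloc, huniq⟩ := hprop μ hμ
    exact ⟨h2, hgapε _ hr _ hpk μ hμ _ (hw.1.mapsTo hμ), hloc, huniq⟩
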